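/- Let $\Sigma$ be a differential field with derivation $\partial$ whose field of constants $\mathbf{C}$ is algebraically closed of characteristic zero, and let $\Sigma[\partial]$ be the ring of linear differential operators over $\Sigma$ (so $\partial a=a\partial+\partial(a)$ for $a\in\Sigma$). Let $P,Q\in\Sigma[\partial]$ be commuting operators of positive orders $n=\mathrm{ord}(P)$ and $m=\mathrm{ord}(Q)$, not both equal to $1$. Let $$\mathtt{BC}(P,Q)=\{g\in\mathbf{C}[\lambda,\mu]\mid g(P,Q)=0\},$$ and let $f\in\mathbf{C}[\lambda,\mu]$ be such that $\mathtt{BC}(P,Q)=(f)$. Assume that the algebra $\mathbf{C}[P,Q]$ has rank $1$, i.e. that the greatest common divisor of the orders of its nonzero elements is $1$; this holds in particular when $\mathrm{rank}(P,Q)=\gcd(n,m)=1$. Extend $\partial$ to $\Sigma[\lambda,\mu]$ by $\partial(\lambda)=\partial(\mu)=0$, and let $[f]$ be the differential ideal of $\Sigma[\lambda,\mu]$ generated by $f$. Then $[f]$ is a prime ideal, so that the fraction field $\Sigma(\Gamma_{P,Q})$ of $\Sigma[\lambda,\mu]/[f]$, with the induced derivation, is a differential field. Let $S_1$ be the matrix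 of size $(n+m-2)\times(n+m-1)$ with entries in $\Sigma[\lambda,\mu]$ whose rows are the coefficients of the operators $$\partial^{m-2}(P-\lambda),\dots,\partial(P-\lambda),\,P-\lambda,\;\partial^{n-2}(Q-\mu),\dots,\partial(Q-\mu),\,Q-\mu$$ (a block with $m-1=0$ or $n-1=0$ operators being empty), with columns indexed by $\partial^{n+m-2},\dots,\partial,1$. For $i=0,1$ let $S_1^i$ be the square matrix obtained from $S_1$ by removing, of the two columns indexed by $\partial$ and $1$, the one that is not indexed by $\partial^i$. Let $$\mathrm{s}\partial\mathrm{Res}_1(P-\lambda,Q-\mu)=\det(S_1^0)+\det(S_1^1)\,\partial$$ be the first differential subresultant. Then, as an operator with coefficients in $\Sigma(\Gamma_{P,Q})$, $\mathrm{s}\partial\mathrm{Res}_1(P-\lambda,Q-\mu)$ has order one and is a greatest common right divisor of $P-\lambda$ and $Q-\mu$ in $\Sigma(\Gamma_{P,Q})[\partial]$ (unique up to multiplication on the left by a nonzero element of $\Sigma(\Gamma_{P,Q})$): it is a right divisor of both, and every common right divisor of both is a right divisor of it. -/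

import Mathlib

open scoped Differential

noncomputable section

namespace BCPlanar

/-! ### The field of constants -/

/-- The field of constants of a differential field. -/
def constField (F : Type*) [Field F] [Differential F] : Subfield F where
  carrier := {c | c′ = 0}
  one_mem' := by simp
  zero_mem' := by simp
  mul_mem' := fun {a b} ha hb => by
    simp only [Set.mem_ofPred_eq] at ha hb
    simp [ha, hb]
  add_mem' := fun {a b} ha hb => by
    simp only [Set.mem_ofPred_eq] at ha hb
    simp [ha, hb]
  neg_mem' := fun {a} ha => by
    simp only [Set.mem_ofPred_eq] at ha
    simp [ha]
  inv_mem' := fun a ha => by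
    simp only [Set.mem_ofPred_eq] at ha
    simp [Derivation.leibniz_inv, ha]

/-! ### Derivations on polynomial rings, quotients and fraction rings

A derivation `d` of `A` is the same thing as a ring homomorphism `a ↦ a + d(a) ε` from `A` to the
dual numbers over `A`. The derivations below are built in this form; the lemmas that follow each
construction characterize them in the usual way. -/

/-- The homomorphism `a ↦ φ(a) + φ(a′) ε`, for `φ : A → B` and a differential ring `A`. -/
def dualHom {A B : Type*} [CommRing A] [Differential A] [CommRing B] (φ : A →+* B) :
    A →+* DualNumber B where
  toFun a := TrivSqZeroExt.inl (φ a) + TrivSqZeroExt.inr (φ a′)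
  map_one' := by simp
  map_zero' := by simp
  map_mul' a b := by ext <;> simp [mul_comm]
  map_add' a b := by ext <;> simp

/-- The derivation `a ↦ d(a)` that belongs to a ring homomorphism `a ↦ a + d(a) ε`. -/
def derivOfDual {A : Type*} [CommRing A] (ψ : A →+* DualNumber A)
    (h : ∀ a, TrivSqZeroExt.fst (ψ a) = a) : Derivation ℤ A A :=
  Derivation.mk'
    { toFun := fun a => TrivSqZeroExt.snd (ψ a)
      map_add' := fun a b => by simp
      map_smul' := fun n a => by simp }
    (fun a b => by simp [h, mul_comm])

/-- `R[λ, μ]` with the derivation that extends the one of `R` by `λ′ = μ′ = 0`.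
The variables `λ`, `μ` are `X 0`, `X 1`. -/
instance mvDifferential (R : Type*) [CommRing R] [Differential R] :
    Differential (MvPolynomial (Fin 2) R) where
  deriv := derivOfDual
    (MvPolynomial.eval₂Hom (dualHom MvPolynomial.C)
      (fun i => TrivSqZeroExt.inl (MvPolynomial.X i)))
    (fun p => by
      induction p using MvPolynomial.induction_on with
      | C a => simp [dualHom]
      | add p q hp hq => rw [map_add, TrivSqZeroExt.fst_add, hp, hq]
      | mul_X p i hp => rw [map_mul, TrivSqZeroExt.fst_mul, hp]; simp)

lemma mv_deriv_C {R : Type*} [CommRing R] [Differential R] (a : R) :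
    (MvPolynomial.C a : MvPolynomial (Fin 2) R)′ = MvPolynomial.C a′ := by
  simp [Differential.deriv, derivOfDual, dualHom]

lemma mv_deriv_X {R : Type*} [CommRing R] [Differential R] (i : Fin 2) :
    (MvPolynomial.X i : MvPolynomial (Fin 2) R)′ = 0 := by
  simp [Differential.deriv, derivOfDual]

/-- The differential ideal `[S]` generated by a subset `S` of a differential ring: the ideal
generated by all iterated derivatives of the elements of `S`. -/
def diffIdeal {R : Type*} [CommRing R] [Differential R] (S : Set R) : Ideal R :=
  Ideal.span {x | ∃ s ∈ S, ∃ k : ℕ, x = (fun y : R => y′)^[k] s}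

lemma deriv_mem_diffIdeal {R : Type*} [CommRing R] [Differential R] (S : Set R) {x : R}
    (hx : x ∈ diffIdeal S) : x′ ∈ diffIdeal S := by
  induction hx using Submodule.span_induction with
  | mem x hx =>
    obtain ⟨s, hs, k, rfl⟩ := hx
    refine Ideal.subset_span ⟨s, hs, k + 1, ?_⟩
    rw [Function.iterate_succ_apply']
  | zero => simp
  | add x y _ _ hx hy => rw [map_add]; exact add_mem hx hy
  | smul a x hx h =>
    rw [smul_eq_mul, Derivation.leibniz]
    exact add_mem (Ideal.mul_mem_left _ _ h) (by
      rw [smul_eq_mul]; exact Ideal.mul_mem_right _ _ hx)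

/-- The derivation of `R ⧸ [S]` induced by the one of `R`. -/
instance quotDifferential {R : Type*} [CommRing R] [Differential R] (S : Set R) :
    Differential (R ⧸ diffIdeal S) where
  deriv := derivOfDual
    (Ideal.Quotient.lift (diffIdeal S) (dualHom (Ideal.Quotient.mk (diffIdeal S)))
      (fun a ha => by
        ext
        · simpa [dualHom] using Ideal.Quotient.eq_zero_iff_mem.2 ha
        · simpa [dualHom] using
            Ideal.Quotient.eq_zero_iff_mem.2 (deriv_mem_diffIdeal S ha)))
    (fun x => by
      obtain ⟨a, rfl⟩ := Ideal.Quotient.mk_surjective x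
      simp [dualHom])

lemma quot_deriv_mk {R : Type*} [CommRing R] [Differential R] (S : Set R) (a : R) :
    (Ideal.Quotient.mk (diffIdeal S) a)′ = Ideal.Quotient.mk (diffIdeal S) a′ := by
  simp [Differential.deriv, derivOfDual, dualHom]

/-- The derivation of the ring of fractions that extends the one of `A`. -/
instance fracDifferential (A : Type*) [CommRing A] [Differential A] :
    Differential (FractionRing A) where
  deriv := derivOfDual
    (IsLocalization.lift (M := nonZeroDivisors A)
      (g := dualHom (algebraMap A (FractionRing A)))
      (fun s => TrivSqZeroExt.isUnit_iff_isUnit_fst.2 (by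
        simpa [dualHom] using IsLocalization.map_units (FractionRing A) s)))
    (fun x => by
      have key : (TrivSqZeroExt.fstHom (FractionRing A) (FractionRing A) (FractionRing A)).toRingHom.comp
          (IsLocalization.lift (M := nonZeroDivisors A)
            (g := dualHom (algebraMap A (FractionRing A)))
            (fun s => TrivSqZeroExt.isUnit_iff_isUnit_fst.2 (by
              simpa [dualHom] using IsLocalization.map_units (FractionRing A) s))) =
          RingHom.id (FractionRing A) :=
        IsLocalization.ringHom_ext (nonZeroDivisors A) (by
          ext a
          simp [dualHom])
      exact congrArg (fun φ : FractionRing A →+* FractionRing A => φ x) key)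

lemma frac_deriv_algebraMap {A : Type*} [CommRing A] [Differential A] (a : A) :
    (algebraMap A (FractionRing A) a)′ = algebraMap A (FractionRing A) a′ := by
  change TrivSqZeroExt.snd (IsLocalization.lift _ _) = _
  rw [IsLocalization.lift_eq]
  exact (congrArg TrivSqZeroExt.snd rfl).trans (by
    change TrivSqZeroExt.snd (TrivSqZeroExt.inl (algebraMap A (FractionRing A) a) +
      TrivSqZeroExt.inr (algebraMap A (FractionRing A) a′) : DualNumber (FractionRing A)) = _
    rw [TrivSqZeroExt.snd_add, TrivSqZeroExt.snd_inl, TrivSqZeroExt.snd_inr, zero_add])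

/-! ### The ring of differential operators -/

/-- `R[∂]`: the differential operators `∑ aᵢ ∂ⁱ` with coefficients in `R`, as a left `R`-module.
The operator `∑ aᵢ ∂ⁱ` is stored as the sequence of its coefficients, that is, as the polynomial
`∑ aᵢ Xⁱ`. -/
def DiffOp (R : Type*) [CommRing R] : Type _ := Polynomial R

namespace DiffOp

section Module

variable {R : Type*} [CommRing R]

instance : AddCommGroup (DiffOp R) := inferInstanceAs (AddCommGroup (Polynomial R))

instance {S : Type*} [Semiring S] [Module S R] : Module S (DiffOp R) :=
  inferInstanceAs (Module S (Polynomial R))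

/-- The operator `∑ aᵢ ∂ⁱ` of the polynomial `∑ aᵢ Xⁱ`. -/
def ofPoly : Polynomial R ≃ₗ[R] DiffOp R := LinearEquiv.refl R (Polynomial R)

/-- The coefficient of `∂ⁱ`. -/
def coeff (P : DiffOp R) (i : ℕ) : R := (ofPoly.symm P).coeff i

/-- The order of an operator (by convention `0` for the zero operator). -/
def order (P : DiffOp R) : ℕ := (ofPoly.symm P).natDegree

/-- The operator `a ∂⁰` of order zero. -/
def const (a : R) : DiffOp R := ofPoly (Polynomial.C a)

/-- The operator `∂`. -/
def del : DiffOp R := ofPoly Polynomial.X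

/-- Change of coefficients along a ring homomorphism. -/
def map {S : Type*} [CommRing S] (φ : R →+* S) (P : DiffOp R) : DiffOp S :=
  ofPoly ((ofPoly.symm P).map φ)

end Module

section Ring

variable {R : Type*} [CommRing R] [Differential R]

/-- Left multiplication by `∂`, as determined by `∂ a = a ∂ + a′`:
`∂ (∑ aᵢ ∂ⁱ) = ∑ aᵢ ∂ⁱ⁺¹ + ∑ aᵢ′ ∂ⁱ`. -/
def delMul : Module.End ℤ (Polynomial R) :=
  LinearMap.mulLeft ℤ Polynomial.X + (Differential.mapCoeffs : Derivation ℤ _ _).toLinearMap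

/-- Left multiplication by an operator: `∑ aᵢ ∂ⁱ` maps `q` to `∑ aᵢ (∂ⁱ q)`. -/
def leftMul : Polynomial R →ₗ[R] Module.End ℤ (Polynomial R) :=
  Polynomial.lsum fun i => LinearMap.toSpanSingleton R _ (delMul ^ i)

instance : Mul (DiffOp R) where
  mul P Q := ofPoly (leftMul (ofPoly.symm P) (ofPoly.symm Q))

instance : One (DiffOp R) where
  one := const 1


lemma delMul_apply (q : Polynomial R) :
    delMul q = Polynomial.X * q + Differential.mapCoeffs q := rfl

lemma leftMul_monomial (k : ℕ) (a : R) :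
    leftMul (Polynomial.monomial k a) = a • (delMul : Module.End ℤ (Polynomial R)) ^ k := by
  simp [leftMul, Polynomial.lsum_apply]

lemma mapCoeffs_smul (a : R) (q : Polynomial R) :
    Differential.mapCoeffs (a • q) = a • Differential.mapCoeffs q + a′ • q := by
  rw [Polynomial.smul_eq_C_mul, Derivation.leibniz, Differential.mapCoeffs_C]
  simp only [smul_eq_mul, Polynomial.smul_eq_C_mul, mul_comm]

lemma delMul_smul (a : R) (q : Polynomial R) :
    delMul (a • q) = a • delMul q + a′ • q := by
  rw [delMul_apply, delMul_apply, mapCoeffs_smul, mul_smul_comm, smul_add, add_assoc]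

lemma leftMul_delMul (q : Polynomial R) : leftMul (delMul q) = delMul * leftMul q := by
  induction q using Polynomial.induction_on' with
  | add p q hp hq => rw [map_add, map_add, map_add, hp, hq, mul_add]
  | monomial k a =>
    ext1 r
    rw [delMul_apply, Polynomial.X_mul_monomial, Differential.mapCoeffs_monomial, map_add,
      leftMul_monomial, leftMul_monomial, leftMul_monomial]
    simp only [LinearMap.add_apply, LinearMap.smul_apply, Module.End.mul_apply, delMul_smul,
      pow_succ', Module.End.mul_apply]

lemma leftMul_leftMul (p q : Polynomial R) : leftMul (leftMul p q) = leftMul p * leftMul q := by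
  induction p using Polynomial.induction_on' with
  | add p p' hp hp' => rw [map_add, LinearMap.add_apply, map_add, hp, hp', add_mul]
  | monomial k a =>
    have h : ∀ j : ℕ, leftMul (((delMul : Module.End ℤ (Polynomial R)) ^ j) q) =
        delMul ^ j * leftMul q := by
      intro j
      induction j with
      | zero => simp
      | succ j ih =>
        rw [pow_succ', Module.End.mul_apply, leftMul_delMul, ih, mul_assoc]
    rw [leftMul_monomial, LinearMap.smul_apply, map_smul, h, smul_mul_assoc]

lemma leftMul_C_one : leftMul (Polynomial.C (1 : R)) = 1 := by
  rw [← Polynomial.monomial_zero_left, leftMul_monomial, pow_zero, one_smul]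

lemma leftMul_C (p : Polynomial R) {c : R} (hc : c′ = 0) :
    leftMul p (Polynomial.C c) = c • p := by
  induction p using Polynomial.induction_on' with
  | add p q hp hq => rw [map_add, LinearMap.add_apply, hp, hq, smul_add]
  | monomial k a =>
    have h : ∀ j : ℕ, ((delMul : Module.End ℤ (Polynomial R)) ^ j) (Polynomial.C c) =
        Polynomial.monomial j c := by
      intro j
      induction j with
      | zero => simp
      | succ j ih =>
        rw [pow_succ', Module.End.mul_apply, ih, delMul_apply, Polynomial.X_mul_monomial,
          Differential.mapCoeffs_monomial, hc]
        simp
    rw [leftMul_monomial, LinearMap.smul_apply, h, Polynomial.smul_monomial,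
      Polynomial.smul_monomial, smul_eq_mul, smul_eq_mul, mul_comm]

lemma leftMul_smul (p q : Polynomial R) {c : R} (hc : c′ = 0) :
    leftMul p (c • q) = c • leftMul p q := by
  have h : c • q = leftMul (Polynomial.C c) q := by
    rw [← Polynomial.monomial_zero_left, leftMul_monomial]
    simp
  have h' : leftMul p (c • q) = leftMul (leftMul p (Polynomial.C c)) q := by
    rw [h, leftMul_leftMul, Module.End.mul_apply]
  rw [h', leftMul_C p hc, map_smul, LinearMap.smul_apply]

instance : Ring (DiffOp R) :=
  { (inferInstance : AddCommGroup (DiffOp R)) with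
    mul := (· * ·)
    one := 1
    left_distrib := fun P Q T => map_add (leftMul (ofPoly.symm P)) _ _
    right_distrib := fun P Q T => by
      change leftMul (ofPoly.symm P + ofPoly.symm Q) _ = _
      rw [map_add]; rfl
    zero_mul := fun P => by
      change leftMul (0 : Polynomial R) (ofPoly.symm P) = (0 : Polynomial R)
      rw [map_zero, LinearMap.zero_apply]
    mul_zero := fun P => map_zero (leftMul (ofPoly.symm P))
    mul_assoc := fun P Q T => by
      change leftMul (leftMul (ofPoly.symm P) (ofPoly.symm Q)) (ofPoly.symm T) =
        leftMul (ofPoly.symm P) (leftMul (ofPoly.symm Q) (ofPoly.symm T))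
      rw [leftMul_leftMul]; rfl
    one_mul := fun P => by
      change leftMul (Polynomial.C 1) (ofPoly.symm P) = _
      rw [leftMul_C_one]; rfl
    mul_one := fun P => by
      change leftMul (ofPoly.symm P) (Polynomial.C 1) = _
      rw [leftMul_C _ (by simp), one_smul]; rfl }

/-- The defining relation `∂ a = a ∂ + a′` of `R[∂]`. -/
lemma del_mul_const (a : R) : (del * const a : DiffOp R) = a • del + const a′ := by
  have h : leftMul Polynomial.X (Polynomial.C a) = a • Polynomial.X + Polynomial.C a′ := by
    rw [← Polynomial.monomial_one_one_eq_X, leftMul_monomial, pow_one, one_smul, delMul_apply,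
      Differential.mapCoeffs_C, Polynomial.monomial_one_one_eq_X, Polynomial.smul_eq_C_mul,
      mul_comm]
  exact h

/-- Multiplication from the left by an operator of order zero is coefficientwise. -/
lemma const_mul (a : R) (P : DiffOp R) : const a * P = a • P := by
  change leftMul (Polynomial.C a) (ofPoly.symm P) = a • ofPoly.symm P
  rw [← Polynomial.monomial_zero_left, leftMul_monomial]
  simp

/-- An operator is the sum of its terms `aᵢ ∂ⁱ`. -/
lemma eq_sum (P : DiffOp R) :
    P = ∑ i ∈ Finset.range (P.order + 1), P.coeff i • (del : DiffOp R) ^ i := by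
  have h : ∀ j : ℕ, (del : DiffOp R) ^ j = ofPoly (Polynomial.X ^ j) := by
    intro j
    induction j with
    | zero => rfl
    | succ j ih =>
      rw [pow_succ', ih]
      change leftMul Polynomial.X (Polynomial.X ^ j) = Polynomial.X ^ (j + 1)
      rw [← Polynomial.monomial_one_one_eq_X, leftMul_monomial, pow_one, one_smul, delMul_apply,
        Polynomial.monomial_one_one_eq_X, Derivation.leibniz_pow, Differential.mapCoeffs_X,
        pow_succ']
      simp
  simp only [h]
  apply ofPoly.symm.injective
  rw [map_sum]
  simp only [map_smul, LinearEquiv.symm_apply_apply, Polynomial.smul_eq_C_mul]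
  exact Polynomial.as_sum_range_C_mul_X_pow (ofPoly.symm P)

end Ring

/-- The field of constants of `F` is central in `F[∂]`. -/
instance {F : Type*} [Field F] [Differential F] : Algebra (constField F) (DiffOp F) :=
  Algebra.ofModule
    (fun c P Q => by
      change leftMul ((c : F) • ofPoly.symm P) (ofPoly.symm Q) = _
      rw [map_smul]; rfl)
    (fun c P Q => leftMul_smul (ofPoly.symm P) (ofPoly.symm Q) (c := (c : F)) c.2)

end DiffOp

/-! ### Rank, Burchnall–Chaundy ideal and the field of the spectral curve -/

/-- The rank of a set of differential operators: the greatest common divisor of the orders of its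
nonzero elements. -/
def rank {R : Type*} [CommRing R] (S : Set (DiffOp R)) : ℕ :=
  sSup {d : ℕ | ∀ T ∈ S, T ≠ 0 → d ∣ T.order}

section Curve

variable {F : Type*} [Field F] [Differential F]

/-- The commutative algebra `C[P, Q]` generated by `P` and `Q` over the field of constants `C`. -/
def pairAlgebra (P Q : DiffOp F) : Subalgebra (constField F) (DiffOp F) :=
  Algebra.adjoin (constField F) {P, Q}

/-- If already the set `{P, Q}` has rank one, that is, if the orders of `P` and `Q` are coprime,
then `C[P, Q]` has rank one. -/
lemma rank_pairAlgebra_of_coprime (P Q : DiffOp F) (h : Nat.Coprime P.order Q.order) :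
    rank (pairAlgebra P Q : Set (DiffOp F)) = 1 := by
  have key : ∀ T ∈ pairAlgebra P Q, ∀ d : ℕ,
      (∀ T ∈ (pairAlgebra P Q : Set (DiffOp F)), T ≠ 0 → d ∣ T.order) → d ∣ T.order := by
    intro T hT d hd
    by_cases h0 : T = 0
    · rw [h0]
      exact dvd_zero d
    · exact hd T hT h0
  have hset : {d : ℕ | ∀ T ∈ (pairAlgebra P Q : Set (DiffOp F)), T ≠ 0 → d ∣ T.order} = {1} := by
    ext d
    constructor
    · intro hd
      exact Nat.eq_one_of_dvd_coprimes h
        (key P (Algebra.subset_adjoin (by simp)) d hd)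
        (key Q (Algebra.subset_adjoin (by simp)) d hd)
    · rintro rfl T _ _
      exact one_dvd _
  rw [rank, hset, csSup_singleton]

lemma pairAlgebra_comm {P Q : DiffOp F} (h : Commute P Q) :
    ∀ a ∈ ({P, Q} : Set (DiffOp F)), ∀ b ∈ ({P, Q} : Set (DiffOp F)), a * b = b * a := by
  rintro a (rfl | rfl) b (rfl | rfl)
  · rfl
  · exact h
  · exact h.symm
  · rfl

open scoped IsMulCommutative in
/-- The homomorphism `C[λ, μ] → F[∂]`, `λ ↦ P`, `μ ↦ Q`, for commuting operators `P` and `Q`. -/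
def evalPair (P Q : DiffOp F) (h : Commute P Q) :
    MvPolynomial (Fin 2) (constField F) →ₐ[constField F] DiffOp F :=
  haveI : IsMulCommutative (pairAlgebra P Q) :=
    Algebra.isMulCommutative_adjoin (constField F) (pairAlgebra_comm h)
  (pairAlgebra P Q).val.comp
    (MvPolynomial.aeval ![⟨P, Algebra.subset_adjoin (by simp)⟩,
      ⟨Q, Algebra.subset_adjoin (by simp)⟩])

lemma evalPair_X_zero (P Q : DiffOp F) (h : Commute P Q) :
    evalPair P Q h (MvPolynomial.X 0) = P := by
  simp [evalPair]

lemma evalPair_X_one (P Q : DiffOp F) (h : Commute P Q) :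
    evalPair P Q h (MvPolynomial.X 1) = Q := by
  simp [evalPair]

/-- The ideal `BC(P, Q)` of all Burchnall–Chaundy polynomials: the polynomials `g(λ, μ)` with
constant coefficients such that `g(P, Q) = 0`. -/
def BC (P Q : DiffOp F) (h : Commute P Q) : Ideal (MvPolynomial (Fin 2) (constField F)) :=
  RingHom.ker (evalPair P Q h)

/-- The differential ideal `[f]` of `F[λ, μ]` generated by a polynomial `f(λ, μ)` with constant
coefficients. -/
abbrev curveIdeal (f : MvPolynomial (Fin 2) (constField F)) : Ideal (MvPolynomial (Fin 2) F) :=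
  diffIdeal {MvPolynomial.map (constField F).subtype f}

/-- The differential ring `F[Γ] = F[λ, μ] / [f]`. -/
abbrev CurveRing (f : MvPolynomial (Fin 2) (constField F)) : Type _ :=
  MvPolynomial (Fin 2) F ⧸ curveIdeal f

/-- `F(Γ)`, the ring of fractions of `F[Γ]` (the fraction field if `[f]` is prime), with the
induced derivation. -/
abbrev CurveField (f : MvPolynomial (Fin 2) (constField F)) : Type _ :=
  FractionRing (CurveRing f)

/-- The canonical map `F[λ, μ] → F(Γ)`. -/
def toCurveField (f : MvPolynomial (Fin 2) (constField F)) :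
    MvPolynomial (Fin 2) F →+* CurveField f :=
  (algebraMap (CurveRing f) (CurveField f)).comp (Ideal.Quotient.mk (curveIdeal f))

/-- The operator `P - λ` (for `i = 0`) or `P - μ` (for `i = 1`), with coefficients in
`F[λ, μ]`; the variables are `λ = X 0` and `μ = X 1`. -/
def shift (P : DiffOp F) (i : Fin 2) : DiffOp (MvPolynomial (Fin 2) F) :=
  P.map MvPolynomial.C - DiffOp.const (MvPolynomial.X i)

end Curve

/-! ### Differential subresultants -/

section Subresultant

variable {R : Type*} [CommRing R] [Differential R]

/-- The `r`-th row of the extended system `Ξ_k`: with `n = ord A` and `m = ord B`, the list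
`∂^(m-1-k) A, …, ∂ A, A, ∂^(n-1-k) B, …, ∂ B, B` of `n + m - 2k` operators. -/
def extSystem (k : ℕ) (A B : DiffOp R) (r : Fin (A.order + B.order - 2 * k)) : DiffOp R :=
  if (r : ℕ) < B.order - k then DiffOp.del ^ (B.order - k - 1 - r) * A
  else DiffOp.del ^ (A.order + B.order - 2 * k - 1 - r) * B

/-- The matrix `S_k^i`: the rows are the coefficients of the operators of `Ξ_k`, the columns are
those indexed by `∂^(n+m-k-1), …, ∂^(k+1)` and, as the last one, the column indexed by `∂^i`. -/
def subresMatrix (k i : ℕ) (A B : DiffOp R) :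
    Matrix (Fin (A.order + B.order - 2 * k)) (Fin (A.order + B.order - 2 * k)) R :=
  Matrix.of fun r c => (extSystem k A B r).coeff
    (if (c : ℕ) + 1 < A.order + B.order - 2 * k then A.order + B.order - k - 1 - c else i)

/-- The `k`-th differential subresultant `∑_{i ≤ k} det (S_k^i) ∂^i` of `A` and `B`. -/
def subres (k : ℕ) (A B : DiffOp R) : DiffOp R :=
  ∑ i ∈ Finset.range (k + 1), (subresMatrix k i A B).det • (DiffOp.del : DiffOp R) ^ i

/-- `G` is a right divisor of `A`. -/
def RightDvd (G A : DiffOp R) : Prop := ∃ T : DiffOp R, A = T * G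

/-- `G` is a greatest common right divisor of `A` and `B`. -/
def IsGCRD (G A B : DiffOp R) : Prop :=
  RightDvd G A ∧ RightDvd G B ∧ ∀ H : DiffOp R, RightDvd H A → RightDvd H B → RightDvd H G

end Subresultant
end BCPlanar

end

open BCPlanar

namespace BCPlanar
namespace DiffOp

/-! ### Coefficients and orders of operators. -/

section Semi

variable {R : Type*} [CommRing R]

/-! Write `D = F[∂]` and `A = F[λ, μ]`. The proof makes `D` an `A`-module: `F` acts by left
multiplication, `λ` and `μ` by right multiplication by `P` and `Q` (`act`). A polynomial with
constant coefficients then acts as right multiplication by its value at `(P, Q)`, so `[f]` acts as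
zero.

Conversely, every `g ∉ [f]` acts injectively. Operators commuting with `P` and having the same order
have leading coefficients that differ by a constant factor (characteristic zero enters here). Hence,
modulo `[f]`, the filtration of `A` by the order of `t(P, Q)` has graded pieces of dimension at most
one over `F`, and the leading part of `g` is `a t` with `a ∈ F` nonzero and `t` constant. It raises
orders by exactly `ord t(P, Q)`, so nothing cancels it (`act_apply_ne_zero`). Primality of `[f]`
follows at once.

Let `J` be the left ideal of `F(Γ)[∂]` generated by `P - λ` and `Q - μ`. The map `∑ gᵢ ∂ⁱ ↦ ∑ gᵢ ·
∂ⁱ` (`reduction`) kills the left ideal of `A[∂]` generated by these operators. Were `1 ∈ J`,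
clearing denominators would give some `d ∉ [f]` with `d · 1 = 0`; so `J` is proper. In rank one,
every large integer is an order in `C[P, Q]`, so `D / (A · 1)` is finite-dimensional over `F`, and
comparison with the infinite dimension of `D` yields `r · ∂ = s · 1` with `r ∉ [f]`. Then `r ∂ - s ∈
J`: `J` is proper and contains an operator `G` of order one, hence is generated by it.

The subresultant lies in `J` by Cramer's rule, so it remains to see that its coefficient at `∂` is
nonzero (`det_subresMatrix_one_ne_zero`). Otherwise there is a relation `U (P - λ) + V (Q - μ) = 0`
with `U ≠ 0` and `ord U < m - 1`. Cancelling `G` on the right leaves coprime cofactors, and a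
dimension count forces `ord U ≥ m - 1`. -/

instance [Nontrivial R] : Nontrivial (DiffOp R) := inferInstanceAs (Nontrivial (Polynomial R))

lemma coeff_add (U V : DiffOp R) (i : ℕ) : (U + V).coeff i = U.coeff i + V.coeff i :=
  Polynomial.coeff_add _ _ _

lemma coeff_sub (U V : DiffOp R) (i : ℕ) : (U - V).coeff i = U.coeff i - V.coeff i :=
  Polynomial.coeff_sub _ _ _

lemma coeff_smul (a : R) (V : DiffOp R) (i : ℕ) : (a • V).coeff i = a * V.coeff i :=
  Polynomial.coeff_smul _ _ _

lemma coeff_zero (i : ℕ) : (0 : DiffOp R).coeff i = 0 := Polynomial.coeff_zero _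

lemma coeff_sum {ι : Type*} (s : Finset ι) (U : ι → DiffOp R) (i : ℕ) :
    (∑ r ∈ s, U r).coeff i = ∑ r ∈ s, (U r).coeff i :=
  Polynomial.finsetSum_coeff s U i

lemma coeff_const (a : R) (i : ℕ) : (const a).coeff i = if i = 0 then a else 0 :=
  Polynomial.coeff_C

lemma ext_coeff {U V : DiffOp R} (h : ∀ i, U.coeff i = V.coeff i) : U = V :=
  Polynomial.ext h

lemma const_zero : (const 0 : DiffOp R) = 0 := Polynomial.C_0

lemma one_eq_const : (1 : DiffOp R) = const 1 := rfl

/-- The order of an operator, with the convention `⊥` for the zero operator. -/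
noncomputable def deg (U : DiffOp R) : WithBot ℕ := (ofPoly.symm U).degree

lemma deg_lt_iff {U : DiffOp R} {n : ℕ} : U.deg < n ↔ ∀ i, n ≤ i → U.coeff i = 0 :=
  Polynomial.degree_lt_iff_coeff_zero _ _

lemma deg_eq_bot {U : DiffOp R} : U.deg = ⊥ ↔ U = 0 := Polynomial.degree_eq_bot

lemma deg_eq_order {U : DiffOp R} (h : U ≠ 0) : U.deg = U.order :=
  Polynomial.degree_eq_natDegree h

lemma coeff_order_ne_zero {U : DiffOp R} (h : U ≠ 0) : U.coeff U.order ≠ 0 :=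
  Polynomial.leadingCoeff_ne_zero.2 h

lemma coeff_eq_zero_of_order_lt {U : DiffOp R} {i : ℕ} (h : U.order < i) : U.coeff i = 0 :=
  Polynomial.coeff_eq_zero_of_natDegree_lt h

lemma order_eq_of {U : DiffOp R} {n : ℕ} (h : ∀ i, n < i → U.coeff i = 0)
    (hn : U.coeff n ≠ 0) : U.order = n :=
  le_antisymm (Polynomial.natDegree_le_iff_coeff_eq_zero.2 h) (Polynomial.le_natDegree_of_ne_zero hn)

lemma deg_eq_of {U : DiffOp R} {n : ℕ} (h : ∀ i, n < i → U.coeff i = 0)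
    (hn : U.coeff n ≠ 0) : U.deg = n := by
  have h0 : U ≠ 0 := by rintro rfl; exact hn (coeff_zero n)
  rw [deg_eq_order h0, order_eq_of h hn]

lemma eq_const_of_deg_lt_one {U : DiffOp R} (h : U.deg < (1 : ℕ)) : U = const (U.coeff 0) := by
  refine ext_coeff fun i => ?_
  rw [coeff_const]
  split_ifs with hi
  · rw [hi]
  · exact deg_lt_iff.1 h i (by omega)

lemma coeff_map {S : Type*} [CommRing S] (φ : R →+* S) (U : DiffOp R) (i : ℕ) :
    (U.map φ).coeff i = φ (U.coeff i) :=
  Polynomial.coeff_map φ i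

lemma map_add {S : Type*} [CommRing S] (φ : R →+* S) (U V : DiffOp R) :
    (U + V).map φ = U.map φ + V.map φ := Polynomial.map_add φ

lemma map_sub {S : Type*} [CommRing S] (φ : R →+* S) (U V : DiffOp R) :
    (U - V).map φ = U.map φ - V.map φ := Polynomial.map_sub φ

lemma map_smul {S : Type*} [CommRing S] (φ : R →+* S) (a : R) (U : DiffOp R) :
    (a • U).map φ = φ a • U.map φ := Polynomial.map_smul φ a

lemma map_const {S : Type*} [CommRing S] (φ : R →+* S) (a : R) :
    (const a).map φ = const (φ a) := Polynomial.map_C φ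

lemma map_one {S : Type*} [CommRing S] (φ : R →+* S) : (1 : DiffOp R).map φ = 1 := by
  rw [one_eq_const, map_const, _root_.map_one, one_eq_const]

lemma map_del {S : Type*} [CommRing S] (φ : R →+* S) :
    (del : DiffOp R).map φ = del := Polynomial.map_X φ

lemma coeff_del (i : ℕ) : (del : DiffOp R).coeff i = if i = 1 then 1 else 0 := by
  rw [show (del : DiffOp R).coeff i = (Polynomial.X : Polynomial R).coeff i from rfl,
    Polynomial.coeff_X]
  simp only [eq_comm]

end Semi

/-! ### Leading and subleading coefficients of products; change of coefficients. -/

section Mul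

variable {R : Type*} [CommRing R] [Differential R]

lemma smul_mul (a : R) (U V : DiffOp R) : a • U * V = a • (U * V) := by
  rw [← const_mul, ← const_mul, mul_assoc]

lemma smul_one_eq_const (a : R) : a • (1 : DiffOp R) = const a := by
  rw [← const_mul, mul_one]

lemma del_mul_coeff_succ (U : DiffOp R) (i : ℕ) :
    (del * U).coeff (i + 1) = U.coeff i + (U.coeff (i + 1))′ := by
  have h : (del * U : DiffOp R) = ofPoly (delMul (ofPoly.symm U)) := by
    change leftMul Polynomial.X (ofPoly.symm U) = _
    rw [← Polynomial.monomial_one_one_eq_X, leftMul_monomial, pow_one, one_smul]; rfl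
  rw [h, delMul_apply]
  simp [coeff]

lemma del_mul_coeff_zero (U : DiffOp R) : (del * U).coeff 0 = (U.coeff 0)′ := by
  have h : (del * U : DiffOp R) = ofPoly (delMul (ofPoly.symm U)) := by
    change leftMul Polynomial.X (ofPoly.symm U) = _
    rw [← Polynomial.monomial_one_one_eq_X, leftMul_monomial, pow_one, one_smul]; rfl
  rw [h, delMul_apply]
  simp [coeff]

lemma coeff_del_pow (k i : ℕ) : ((del : DiffOp R) ^ k).coeff i = if i = k then 1 else 0 := by
  induction k generalizing i with
  | zero => rw [pow_zero, one_eq_const, coeff_const]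
  | succ k ih =>
    rw [pow_succ']
    cases i with
    | zero => rw [del_mul_coeff_zero, ih]; split_ifs <;> simp_all
    | succ i =>
      rw [del_mul_coeff_succ, ih, ih]
      by_cases h : i + 1 = k
      · simp [h, show i ≠ k by omega]
      · simp [h]

lemma coeff_del_pow_mul_of_lt (V : DiffOp R) {n : ℕ} (hV : ∀ i, n < i → V.coeff i = 0)
    (k : ℕ) : ∀ i, n + k < i → (del ^ k * V).coeff i = 0 := by
  induction k with
  | zero => simpa using hV
  | succ k ih =>
    intro i hi
    obtain ⟨i, rfl⟩ : ∃ l, i = l + 1 := ⟨i - 1, by omega⟩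
    rw [pow_succ', mul_assoc, del_mul_coeff_succ, ih i (by omega), ih (i + 1) (by omega)]
    simp

lemma coeff_del_pow_mul_top (V : DiffOp R) {n : ℕ} (hV : ∀ i, n < i → V.coeff i = 0)
    (k : ℕ) : (del ^ k * V).coeff (n + k) = V.coeff n := by
  induction k with
  | zero => simp
  | succ k ih =>
    rw [pow_succ', mul_assoc, ← add_assoc, del_mul_coeff_succ, ih,
      coeff_del_pow_mul_of_lt V hV k _ (by omega)]
    simp

lemma coeff_del_pow_mul_second (V : DiffOp R) {n : ℕ} (hV : ∀ i, n + 1 < i → V.coeff i = 0)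
    (k : ℕ) : (del ^ k * V).coeff (n + k) = V.coeff n + k * (V.coeff (n + 1))′ := by
  induction k with
  | zero => simp
  | succ k ih =>
    rw [pow_succ', mul_assoc, ← add_assoc, del_mul_coeff_succ, ih,
      show n + k + 1 = n + 1 + k by ring, coeff_del_pow_mul_top V hV k]
    push_cast
    ring

lemma eq_sum_of_bound (U : DiffOp R) {m : ℕ} (hU : ∀ i, m < i → U.coeff i = 0) :
    U = ∑ i ∈ Finset.range (m + 1), U.coeff i • (del : DiffOp R) ^ i := by
  refine ext_coeff fun j => ?_
  rw [coeff_sum]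
  simp only [coeff_smul, coeff_del_pow, mul_ite, mul_one, mul_zero, Finset.sum_ite_eq,
    Finset.mem_range]
  split_ifs with h
  · rfl
  · exact hU j (by omega)

lemma coeff_mul_eq_sum (U V : DiffOp R) {m : ℕ} (hU : ∀ i, m < i → U.coeff i = 0) (j : ℕ) :
    (U * V).coeff j =
      ∑ i ∈ Finset.range (m + 1), U.coeff i * ((del : DiffOp R) ^ i * V).coeff j := by
  conv_lhs => rw [eq_sum_of_bound U hU, Finset.sum_mul, coeff_sum]
  simp only [smul_mul, coeff_smul]

lemma coeff_mul_of_lt {U V : DiffOp R} {m n : ℕ} (hU : ∀ i, m < i → U.coeff i = 0)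
    (hV : ∀ i, n < i → V.coeff i = 0) : ∀ i, m + n < i → (U * V).coeff i = 0 := by
  intro i hi
  rw [coeff_mul_eq_sum U V hU]
  refine Finset.sum_eq_zero fun k hk => ?_
  rw [Finset.mem_range] at hk
  rw [coeff_del_pow_mul_of_lt V hV k i (by omega), mul_zero]

lemma coeff_mul_top {U V : DiffOp R} {m n : ℕ} (hU : ∀ i, m < i → U.coeff i = 0)
    (hV : ∀ i, n < i → V.coeff i = 0) : (U * V).coeff (m + n) = U.coeff m * V.coeff n := by
  rw [coeff_mul_eq_sum U V hU, Finset.sum_range_succ, Finset.sum_eq_zero, zero_add, add_comm m n,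
    coeff_del_pow_mul_top V hV]
  intro k hk
  rw [Finset.mem_range] at hk
  rw [coeff_del_pow_mul_of_lt V hV k _ (by omega), mul_zero]

/-- The subleading coefficient is the first one that sees the derivation; comparing it in `U V` and
`V U` constrains the leading coefficients of commuting operators. -/
lemma coeff_mul_second {U V : DiffOp R} {m n : ℕ} (hU : ∀ i, m + 1 < i → U.coeff i = 0)
    (hV : ∀ i, n + 1 < i → V.coeff i = 0) :
    (U * V).coeff (m + n + 1) = U.coeff (m + 1) * (V.coeff n + (m + 1) * (V.coeff (n + 1))′) +
      U.coeff m * V.coeff (n + 1) := by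
  rw [coeff_mul_eq_sum U V hU, Finset.sum_range_succ, Finset.sum_range_succ,
    Finset.sum_eq_zero, zero_add, show m + n + 1 = n + (m + 1) by ring,
    coeff_del_pow_mul_second V hV (m + 1), show n + (m + 1) = n + 1 + m by ring,
    coeff_del_pow_mul_top V hV m]
  · push_cast
    ring
  · intro k hk
    rw [Finset.mem_range] at hk
    rw [coeff_del_pow_mul_of_lt V hV k _ (by omega), mul_zero]

lemma deg_mul [IsDomain R] (U V : DiffOp R) : (U * V).deg = U.deg + V.deg := by
  by_cases hU : U = 0
  · rw [hU, zero_mul, deg_eq_bot.2 rfl, WithBot.bot_add]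
  by_cases hV : V = 0
  · rw [hV, mul_zero, deg_eq_bot.2 rfl, WithBot.add_bot]
  have h1 : ∀ i, U.order < i → U.coeff i = 0 := fun i => coeff_eq_zero_of_order_lt
  have h2 : ∀ i, V.order < i → V.coeff i = 0 := fun i => coeff_eq_zero_of_order_lt
  rw [deg_eq_order hU, deg_eq_order hV, ← Nat.cast_add]
  refine deg_eq_of (coeff_mul_of_lt h1 h2) ?_
  rw [coeff_mul_top h1 h2]
  exact mul_ne_zero (coeff_order_ne_zero hU) (coeff_order_ne_zero hV)

instance [IsDomain R] : NoZeroDivisors (DiffOp R) where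
  eq_zero_or_eq_zero_of_mul_eq_zero := by
    intro U V h
    rw [← deg_eq_bot, deg_mul, WithBot.add_eq_bot, deg_eq_bot, deg_eq_bot] at h
    exact h

lemma deg_del_pow [Nontrivial R] (k : ℕ) : ((del : DiffOp R) ^ k).deg = k :=
  deg_eq_of (fun i hi => by rw [coeff_del_pow, if_neg (by omega)])
    (by rw [coeff_del_pow, if_pos rfl]; exact one_ne_zero)

lemma const_mul_del_pow_comm {a : R} (ha : a′ = 0) (k : ℕ) :
    (del : DiffOp R) ^ k * const a = a • (del : DiffOp R) ^ k := by
  induction k with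
  | zero => rw [pow_zero, one_mul, smul_one_eq_const]
  | succ k ih =>
    rw [pow_succ, mul_assoc, del_mul_const, ha, const_zero, add_zero, ← const_mul, ← mul_assoc, ih, smul_mul]

lemma mul_const_of_constant {a : R} (ha : a′ = 0) (U : DiffOp R) : U * const a = a • U := by
  conv_lhs => rw [eq_sum U, Finset.sum_mul]
  conv_rhs => rw [eq_sum U, Finset.smul_sum]
  refine Finset.sum_congr rfl fun i _ => ?_
  rw [smul_mul, const_mul_del_pow_comm ha, smul_comm]

lemma map_sum {S ι : Type*} [CommRing S] (φ : R →+* S) (s : Finset ι) (U : ι → DiffOp R) :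
    (∑ r ∈ s, U r).map φ = ∑ r ∈ s, (U r).map φ := by
  refine ext_coeff fun i => ?_
  rw [coeff_map, coeff_sum, coeff_sum, _root_.map_sum]
  simp only [coeff_map]

section Map

variable {S : Type*} [CommRing S] [Differential S] {φ : R →+* S}

lemma map_del_mul (hφ : ∀ a, φ a′ = (φ a)′) (U : DiffOp R) : (del * U).map φ = del * U.map φ := by
  refine ext_coeff fun i => ?_
  cases i with
  | zero => rw [coeff_map, del_mul_coeff_zero, del_mul_coeff_zero, coeff_map, hφ]
  | succ i =>
    rw [coeff_map, del_mul_coeff_succ, del_mul_coeff_succ, coeff_map, coeff_map, _root_.map_add, hφ]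

lemma map_del_pow_mul (hφ : ∀ a, φ a′ = (φ a)′) (k : ℕ) (U : DiffOp R) : (del ^ k * U).map φ = del ^ k * U.map φ := by
  induction k with
  | zero => simp
  | succ k ih => rw [pow_succ', mul_assoc, map_del_mul hφ, ih, pow_succ', mul_assoc]

lemma map_mul (hφ : ∀ a, φ a′ = (φ a)′) (U V : DiffOp R) : (U * V).map φ = U.map φ * V.map φ := by
  have h : U.map φ = ∑ i ∈ Finset.range (U.order + 1), φ (U.coeff i) • (del : DiffOp S) ^ i := by
    conv_lhs => rw [eq_sum U, map_sum]
    refine Finset.sum_congr rfl fun i _ => ?_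
    rw [map_smul, ← mul_one (del ^ i), map_del_pow_mul hφ, map_one, mul_one]
  conv_lhs => rw [eq_sum U, Finset.sum_mul, map_sum]
  rw [h, Finset.sum_mul]
  refine Finset.sum_congr rfl fun i _ => ?_
  rw [smul_mul, map_smul, map_del_pow_mul hφ, smul_mul]

end Map

end Mul

/-! ### Right division over a differential field. -/

section Division

variable {K : Type*} [Field K] [Differential K]

lemma exists_sub_deg_lt {U V : DiffOp K} {n : ℕ} (hU : U.deg = n) (hV : V.deg = n) :
    ∃ c : K, (U - c • V).deg < n := by
  have hV0 : V ≠ 0 := by rintro rfl; simp [deg_eq_bot.2 rfl] at hV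
  have hn : V.order = n := by rw [deg_eq_order hV0] at hV; exact_mod_cast hV
  have hVn : V.coeff n ≠ 0 := hn ▸ coeff_order_ne_zero hV0
  have hUl : U.deg < (n + 1 : ℕ) := by rw [hU]; exact_mod_cast n.lt_succ_self
  have hVl : V.deg < (n + 1 : ℕ) := by rw [hV]; exact_mod_cast n.lt_succ_self
  refine ⟨U.coeff n / V.coeff n, deg_lt_iff.2 fun i hi => ?_⟩
  rw [coeff_sub, coeff_smul]
  rcases hi.eq_or_lt with rfl | hi
  · field_simp
    ring
  · rw [deg_lt_iff.1 hUl i hi, deg_lt_iff.1 hVl i hi]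
    simp

/-- Right division with remainder. -/
lemma exists_eq_mul_add (U G : DiffOp K) (hG : G ≠ 0) :
    ∃ q r : DiffOp K, U = q * G + r ∧ r.deg < G.deg := by
  suffices h : ∀ (n : ℕ) (U : DiffOp K), U.deg < n →
      ∃ q r : DiffOp K, U = q * G + r ∧ r.deg < G.deg from
    h (U.order + 1) U (deg_lt_iff.2 fun i hi => coeff_eq_zero_of_order_lt hi)
  intro n
  induction n with
  | zero =>
    intro U hU
    refine ⟨0, U, by simp, ?_⟩
    have : U = 0 := ext_coeff fun i => by rw [deg_lt_iff.1 hU i (Nat.zero_le _), coeff_zero]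
    rw [this, deg_eq_bot.2 rfl, bot_lt_iff_ne_bot, ne_eq, deg_eq_bot]
    exact hG
  | succ n ih =>
    intro U hU
    by_cases hlt : U.deg < G.deg
    · exact ⟨0, U, by simp, hlt⟩
    by_cases hU0 : U = 0
    · exact absurd (by rw [hU0, deg_eq_bot.2 rfl, bot_lt_iff_ne_bot, ne_eq, deg_eq_bot]; exact hG) hlt
    rw [deg_eq_order hU0] at hU hlt
    rw [deg_eq_order hG] at hlt
    have hUn : U.order < n + 1 := by exact_mod_cast hU
    have hGU : G.order ≤ U.order := by
      rw [not_lt] at hlt; exact_mod_cast hlt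
    have hd : (del ^ (U.order - G.order) * G : DiffOp K).deg = U.order := by
      rw [deg_mul, deg_del_pow, deg_eq_order hG, ← Nat.cast_add, Nat.sub_add_cancel hGU]
    obtain ⟨c, hc⟩ := exists_sub_deg_lt (deg_eq_order hU0) hd
    obtain ⟨q, r, hqr, hr⟩ := ih _ (hc.trans_le (by exact_mod_cast Nat.lt_succ_iff.1 hUn))
    refine ⟨q + c • del ^ (U.order - G.order), r, ?_, hr⟩
    rw [add_mul, smul_mul, add_right_comm, ← hqr, sub_add_cancel]

end Division

end DiffOp
-- The first subresultant as a combination of its rows.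
section Subresultant

variable {R : Type*} [CommRing R] [Differential R]

open DiffOp

lemma extSystem_one_coeff_eq_zero (A B : DiffOp R) (r : Fin (A.order + B.order - 2 * 1)) (i : ℕ)
    (hi : A.order + B.order - 2 < i) : (extSystem 1 A B r).coeff i = 0 := by
  have hr := r.2
  unfold extSystem
  split_ifs with h
  · exact coeff_del_pow_mul_of_lt A (fun i => coeff_eq_zero_of_order_lt) _ _ (by omega)
  · exact coeff_del_pow_mul_of_lt B (fun i => coeff_eq_zero_of_order_lt) _ _ (by omega)

lemma extSystem_mem_span (k : ℕ) (A B : DiffOp R) (r : Fin (A.order + B.order - 2 * k)) :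
    extSystem k A B r ∈ Ideal.span {A, B} := by
  unfold extSystem
  split_ifs with h
  · exact Ideal.mul_mem_left _ _ (Ideal.subset_span (by simp))
  · exact Ideal.mul_mem_left _ _ (Ideal.subset_span (by simp))

lemma coeff_subres_one (A B : DiffOp R) (i : ℕ) :
    (subres 1 A B).coeff i =
      if i = 0 then (subresMatrix 1 0 A B).det else
      if i = 1 then (subresMatrix 1 1 A B).det else 0 := by
  rw [subres, Finset.sum_range_succ, Finset.sum_range_one, coeff_add, coeff_smul, coeff_smul,
    coeff_del_pow, coeff_del_pow]
  by_cases h0 : i = 0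
  · simp [h0]
  · simp [h0]

/-- The first subresultant is a left linear combination of the operators of the extended system. -/
lemma subres_one_eq_sum (A B : DiffOp R) (h : 3 ≤ A.order + B.order) :
    ∃ c : Fin (A.order + B.order - 2 * 1) → R,
      subres 1 A B = ∑ r, c r • extSystem 1 A B r := by
  have hlast : A.order + B.order - 2 * 1 - 1 < A.order + B.order - 2 * 1 := by omega
  obtain ⟨l, hl⟩ : ∃ l : Fin (A.order + B.order - 2 * 1),
    (l : ℕ) = A.order + B.order - 2 * 1 - 1 := ⟨⟨_, hlast⟩, rfl⟩
  set M := subresMatrix 1 1 A B with hM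
  -- The determinant is linear in its last column; the cofactors of that column, which do not depend
  -- on `i`, are the coefficients sought.
  have key : ∀ v : Fin (A.order + B.order - 2 * 1) → R,
      (M.updateCol l v).det = ∑ r, v r * (M.updateCol l (Pi.single r 1)).det := by
    intro v
    rw [← Matrix.cramer_apply]
    conv_lhs => rw [pi_eq_sum_univ' v, _root_.map_sum]
    rw [Finset.sum_apply]
    refine Finset.sum_congr rfl fun r _ => ?_
    rw [LinearMap.map_smul, Pi.smul_apply, smul_eq_mul, Matrix.cramer_apply]
  have hcol : ∀ i, subresMatrix 1 i A B = M.updateCol l fun r => (extSystem 1 A B r).coeff i := by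
    intro i
    ext r c
    rw [Matrix.updateCol_apply]
    simp only [hM, subresMatrix, Matrix.of_apply]
    by_cases hc : c = l
    · rw [if_pos hc, if_neg (by rw [hc]; omega)]
    · have : (c : ℕ) ≠ l := fun h => hc (Fin.ext h)
      have := c.2
      rw [if_neg hc, if_pos (by omega), if_pos (by omega)]
  refine ⟨fun r => (M.updateCol l (Pi.single r 1)).det, ext_coeff fun i => ?_⟩
  rw [coeff_sum]
  simp only [coeff_smul]
  simp only [mul_comm _ (coeff _ i)]
  rw [← key, coeff_subres_one]
  split_ifs with h0 h1
  · rw [h0, hcol]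
  · rw [h1, hcol]
  -- For `i ≥ 2` the last column either vanishes, beyond the top order, or repeats the earlier
  -- column indexed by `∂^i`.
  · symm
    by_cases hi : A.order + B.order - 2 < i
    · refine Matrix.det_eq_zero_of_column_eq_zero l fun r => ?_
      rw [Matrix.updateCol_self, extSystem_one_coeff_eq_zero A B r i hi]
    · have hne : (⟨A.order + B.order - 2 - i, by omega⟩ : Fin (A.order + B.order - 2 * 1)) ≠ l :=
        fun h => by
          have := congrArg Fin.val h
          simp only at this
          omega
      refine Matrix.det_zero_of_column_eq hne fun r => ?_
      rw [Matrix.updateCol_self, Matrix.updateCol_ne hne, hM, subresMatrix, Matrix.of_apply,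
        if_pos (by simp only; omega)]
      congr 1
      simp only
      omega

lemma subres_one_mem_span (A B : DiffOp R) (h : 3 ≤ A.order + B.order) :
    subres 1 A B ∈ Ideal.span {A, B} := by
  obtain ⟨c, hc⟩ := subres_one_eq_sum A B h
  rw [hc]
  refine sum_mem fun r _ => ?_
  rw [← const_mul]
  exact Ideal.mul_mem_left _ _ (extSystem_mem_span 1 A B r)

end Subresultant

/-! ### Proper left ideals containing an operator of order one. -/

section Field

open DiffOp

variable {K : Type*} [Field K] [Differential K]

lemma map_mem_span_pair {R : Type*} [CommRing R] [Differential R] {φ : R →+* K}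
    (hφ : ∀ a, φ a′ = (φ a)′) {A B U : DiffOp R} (hU : U ∈ Ideal.span {A, B}) :
    U.map φ ∈ Ideal.span {A.map φ, B.map φ} := by
  obtain ⟨X, Y, rfl⟩ := Submodule.mem_span_pair.1 hU
  rw [smul_eq_mul, smul_eq_mul, DiffOp.map_add, map_mul hφ, map_mul hφ]
  exact Submodule.mem_span_pair.2 ⟨_, _, rfl⟩

lemma eq_zero_of_const_mem {J : Ideal (DiffOp K)} (h : 1 ∉ J) {a : K} (ha : const a ∈ J) :
    a = 0 := by
  by_contra h0
  refine h ?_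
  have := J.mul_mem_left (const a⁻¹) ha
  rwa [const_mul, ← smul_one_eq_const a, smul_smul, inv_mul_cancel₀ h0, one_smul] at this

/-- The remainder of a division by `G` has order zero and lies in `J`, so it vanishes: a nonzero one
would be a unit. -/
lemma exists_eq_mul_of_mem {J : Ideal (DiffOp K)} (h : 1 ∉ J) {G : DiffOp K} (hG : G ∈ J)
    (hG1 : G.deg = (1 : ℕ)) {U : DiffOp K} (hU : U ∈ J) : ∃ T, U = T * G := by
  have hG0 : G ≠ 0 := by rintro rfl; simp [deg_eq_bot.2 rfl] at hG1
  obtain ⟨q, r, hqr, hr⟩ := exists_eq_mul_add U G hG0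
  rw [hG1] at hr
  have hrJ : r ∈ J := by
    rw [show r = U - q * G by rw [hqr]; abel]
    exact sub_mem hU (J.mul_mem_left _ hG)
  rw [eq_const_of_deg_lt_one hr] at hrJ
  refine ⟨q, ?_⟩
  rw [hqr, eq_const_of_deg_lt_one hr, eq_zero_of_const_mem h hrJ, const_zero, add_zero]

/-- If `A` and `B` generate the unit left ideal, then a left multiple `U A` of `B` satisfies
`deg B ≤ deg U`. -/
lemma deg_le_of_mul_add_mul_eq_one {A B X Y U V : DiffOp K} (h1 : X * A + Y * B = 1)
    (hUV : U * A = V * B) (hU : U ≠ 0) : B.deg ≤ U.deg := by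
  by_cases hB : B = 0
  · rw [hB, deg_eq_bot.2 rfl]; exact bot_le
  rw [deg_eq_order hB, deg_eq_order hU, Nat.cast_le]
  let mulB : DiffOp K →ₗ[K] DiffOp K :=
    { toFun := fun T => T * B
      map_add' := fun S T => add_mul S T B
      map_smul' := fun a T => smul_mul a T B }
  let mulA : DiffOp K →ₗ[K] DiffOp K :=
    { toFun := fun T => T * A
      map_add' := fun S T => add_mul S T A
      map_smul' := fun a T => smul_mul a T A }
  let N := LinearMap.range mulB
  -- Right multiplication by `A` maps `D / D U` to `D / D B`, since `U A` lies in `D B`.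
  -- Representatives of order below `ord U` and `ord B` turn the comparison of these quotients into
  -- a count of dimensions.
  let θ : Polynomial.degreeLT K U.order →ₗ[K] DiffOp K ⧸ N :=
    N.mkQ ∘ₗ mulA ∘ₗ (ofPoly : Polynomial K ≃ₗ[K] DiffOp K).toLinearMap ∘ₗ
      (Polynomial.degreeLT K U.order).subtype
  let ι : Polynomial.degreeLT K B.order →ₗ[K] DiffOp K ⧸ N :=
    N.mkQ ∘ₗ (ofPoly : Polynomial K ≃ₗ[K] DiffOp K).toLinearMap ∘ₗ
      (Polynomial.degreeLT K B.order).subtype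
  have hfin : ∀ n, Module.Finite K (Polynomial.degreeLT K n) := fun n =>
    Module.Finite.equiv (Polynomial.degreeLTEquiv K n).symm
  have hrk : ∀ n, Module.finrank K (Polynomial.degreeLT K n) = n := fun n => by
    rw [(Polynomial.degreeLTEquiv K n).finrank_eq, Module.finrank_fin_fun]
  have := hfin U.order
  -- Modulo `D B` one has `W = W X A`, and the part of `W X` divisible by `U` contributes nothing.
  have hθ : Function.Surjective θ := by
    intro w
    obtain ⟨W, rfl⟩ := N.mkQ_surjective w
    obtain ⟨q, r, hqr, hr⟩ := exists_eq_mul_add (W * X) U hU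
    rw [deg_eq_order hU] at hr
    refine ⟨⟨ofPoly.symm r, Polynomial.mem_degreeLT.2 hr⟩, ?_⟩
    change N.mkQ (r * A) = N.mkQ W
    rw [← sub_eq_zero, ← _root_.map_sub, Submodule.mkQ_apply, Submodule.Quotient.mk_eq_zero]
    refine ⟨-(q * V + W * Y), ?_⟩
    change -(q * V + W * Y) * B = r * A - W
    have e1 : W = q * V * B + r * A + W * Y * B := by
      calc W = W * X * A + W * Y * B := by rw [mul_assoc, mul_assoc, ← mul_add, h1, mul_one]
        _ = _ := by rw [hqr, add_mul, mul_assoc q, hUV, mul_assoc q]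
    conv_rhs => rw [e1]
    rw [neg_mul, add_mul]
    abel
  have hι : Function.Injective ι := by
    rw [← LinearMap.ker_eq_bot, LinearMap.ker_eq_bot']
    rintro ⟨p, hp⟩ h0
    change N.mkQ (ofPoly p) = 0 at h0
    rw [Submodule.mkQ_apply, Submodule.Quotient.mk_eq_zero] at h0
    obtain ⟨T, hT⟩ := h0
    change T * B = ofPoly p at hT
    have hd : (ofPoly p).deg < B.order := Polynomial.mem_degreeLT.1 hp
    rw [← hT, deg_mul, deg_eq_order hB] at hd
    have hT0 : T = 0 := by
      by_contra hT0
      rw [deg_eq_order hT0] at hd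
      have : T.order + B.order < B.order := by exact_mod_cast hd
      omega
    rw [hT0, zero_mul] at hT
    exact Subtype.ext hT.symm
  have : Module.Finite K (DiffOp K ⧸ N) := Module.Finite.of_surjective θ hθ
  have h2 := LinearMap.finrank_le_finrank_of_injective hι
  have h3 := LinearMap.finrank_le_finrank_of_surjective hθ
  rw [hrk] at h2 h3
  exact h2.trans h3

variable {R : Type*} [CommRing R] [Differential R]

/-- If the images of `A` and `B` generate a proper left ideal that contains an operator of
order one, then the principal coefficient of the first subresultant does not vanish. -/
lemma det_subresMatrix_one_ne_zero {φ : R →+* K} (hφ : ∀ a, φ a′ = (φ a)′) {A B : DiffOp R}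
    (hB : (B.map φ).deg = B.order)
    (hA0 : 0 < A.order) (hB0 : 0 < B.order)
    (h1 : (1 : DiffOp K) ∉ Ideal.span {A.map φ, B.map φ})
    {G : DiffOp K} (hG : G ∈ Ideal.span {A.map φ, B.map φ}) (hG1 : G.deg = (1 : ℕ)) :
    φ (subresMatrix 1 1 A B).det ≠ 0 := by
  intro hdet
  rw [RingHom.map_det, ← Matrix.exists_vecMul_eq_zero_iff] at hdet
  -- A left kernel vector is a linear relation among the rows, in all columns indexed by `∂^i` with
  -- `i ≥ 1`.
  obtain ⟨c, hc, hcM⟩ := hdet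
  let W : DiffOp K := ∑ r, c r • (extSystem 1 A B r).map φ
  have hW : ∀ i, (∑ r, c r * φ ((extSystem 1 A B r).coeff i)) = W.coeff i := by
    intro i
    simp only [W, coeff_sum, coeff_smul, coeff_map]
  have hWi : ∀ i, 1 ≤ i → W.coeff i = 0 := by
    intro i hi
    rw [← hW]
    by_cases hlt : A.order + B.order - 2 < i
    · exact Finset.sum_eq_zero fun r _ => by
        rw [extSystem_one_coeff_eq_zero A B r i hlt, _root_.map_zero, mul_zero]
    · have := congrFun hcM (⟨A.order + B.order - 2 - i, by omega⟩ : Fin (A.order + B.order - 2 * 1))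
      rw [Pi.zero_apply] at this
      rw [← this]
      simp only [Matrix.vecMul, dotProduct, subresMatrix, RingHom.mapMatrix_apply,
        Matrix.map_apply, Matrix.of_apply]
      refine Finset.sum_congr rfl fun r _ => ?_
      congr 3
      split_ifs with h <;> omega
  -- `U` and `V` collect the multipliers of `A` and `B` from the two blocks of rows. The powers of
  -- `∂` within a block are distinct, so the entries of `c` are recovered from the coefficients of
  -- `U` and `V`.
  let U : DiffOp K := ∑ r : Fin (A.order + B.order - 2 * 1), if (r : ℕ) < B.order - 1 then
    c r • (del : DiffOp K) ^ (B.order - 1 - 1 - (r : ℕ)) else 0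
  let V : DiffOp K := ∑ r : Fin (A.order + B.order - 2 * 1), if (r : ℕ) < B.order - 1 then 0 else
    c r • (del : DiffOp K) ^ (A.order + B.order - 2 * 1 - 1 - (r : ℕ))
  have hWUV : W = U * A.map φ + V * B.map φ := by
    simp only [W, U, V, Finset.sum_mul]
    rw [← Finset.sum_add_distrib]
    refine Finset.sum_congr rfl fun r _ => ?_
    unfold extSystem
    split_ifs with h
    · rw [map_del_pow_mul hφ, smul_mul, zero_mul, add_zero]
    · rw [map_del_pow_mul hφ, smul_mul, zero_mul, zero_add]
  have hWJ : W ∈ Ideal.span {A.map φ, B.map φ} := by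
    rw [hWUV]
    exact Submodule.mem_span_pair.2 ⟨U, V, rfl⟩
  -- `W` has only a constant term left and lies in a proper left ideal over a field.
  have hW0 : W = 0 := by
    have hWc : W = const (W.coeff 0) := eq_const_of_deg_lt_one (deg_lt_iff.2 hWi)
    rw [hWc] at hWJ
    rw [hWc, eq_zero_of_const_mem h1 hWJ, const_zero]
  have hUc : ∀ r : Fin (A.order + B.order - 2 * 1), (r : ℕ) < B.order - 1 → U.coeff (B.order - 1 - 1 - r) = c r := by
    intro r hr
    simp only [U, coeff_sum]
    rw [Finset.sum_eq_single r]
    · rw [if_pos hr, coeff_smul, coeff_del_pow, if_pos rfl, mul_one]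
    · intro s _ hs
      have : (s : ℕ) ≠ r := fun h => hs (Fin.ext h)
      split_ifs with h
      · rw [coeff_smul, coeff_del_pow, if_neg (by omega), mul_zero]
      · exact coeff_zero _
    · simp
  have hVc : ∀ r : Fin (A.order + B.order - 2 * 1), ¬ (r : ℕ) < B.order - 1 →
      V.coeff (A.order + B.order - 2 * 1 - 1 - r) = c r := by
    intro r hr
    simp only [V, coeff_sum]
    rw [Finset.sum_eq_single r]
    · rw [if_neg hr, coeff_smul, coeff_del_pow, if_pos rfl, mul_one]
    · intro s _ hs
      have : (s : ℕ) ≠ r := fun h => hs (Fin.ext h)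
      split_ifs with h
      · exact coeff_zero _
      · rw [coeff_smul, coeff_del_pow, if_neg (by omega), mul_zero]
    · simp
  have hUdeg : U.deg < (B.order - 1 : ℕ) := by
    refine deg_lt_iff.2 fun i hi => ?_
    simp only [U, coeff_sum]
    refine Finset.sum_eq_zero fun r _ => ?_
    split_ifs with h
    · rw [coeff_smul, coeff_del_pow, if_neg (by omega), mul_zero]
    · exact coeff_zero _
  rw [hWUV] at hW0
  have hBφ : B.map φ ≠ 0 := by
    intro h0
    rw [h0, deg_eq_bot.2 rfl] at hB
    exact WithBot.bot_ne_coe hB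
  have hU0 : U ≠ 0 := by
    intro hU0
    rw [hU0, zero_mul, zero_add] at hW0
    have hV0 : V = 0 := (mul_eq_zero.1 hW0).resolve_right hBφ
    refine hc (funext fun r => ?_)
    by_cases hr : (r : ℕ) < B.order - 1
    · rw [← hUc r hr, hU0, coeff_zero, Pi.zero_apply]
    · rw [← hVc r hr, hV0, coeff_zero, Pi.zero_apply]
  obtain ⟨X, Y, hXY⟩ := Submodule.mem_span_pair.1 hG
  obtain ⟨A', hA'⟩ := exists_eq_mul_of_mem h1 hG hG1 (Ideal.subset_span (by simp) :
    A.map φ ∈ Ideal.span {A.map φ, B.map φ})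
  obtain ⟨B', hB'⟩ := exists_eq_mul_of_mem h1 hG hG1 (Ideal.subset_span (by simp) :
    B.map φ ∈ Ideal.span {A.map φ, B.map φ})
  have hG0 : G ≠ 0 := by rintro rfl; simp [deg_eq_bot.2 rfl] at hG1
  -- Cancelling `G` in `G = X A' G + Y B' G` makes the cofactors coprime, while `ord B' = ord B - 1`
  -- exceeds `ord U`.
  have hunit : X * A' + Y * B' = 1 := by
    refine mul_right_cancel₀ hG0 ?_
    rw [add_mul, mul_assoc, mul_assoc, ← hA', ← hB', one_mul]
    exact hXY
  have hrel : U * A' = -V * B' := by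
    refine mul_right_cancel₀ hG0 ?_
    rw [mul_assoc, mul_assoc, ← hA', ← hB', neg_mul]
    exact eq_neg_of_add_eq_zero_left hW0
  have hle := deg_le_of_mul_add_mul_eq_one hunit hrel hU0
  have hB'0 : B' ≠ 0 := by
    rintro rfl
    exact hBφ (by rw [hB', zero_mul])
  rw [hB', deg_mul, hG1, deg_eq_order hB'0] at hB
  have hB'' : B'.order + 1 = B.order := by exact_mod_cast hB
  have := hle.trans_lt hUdeg
  rw [deg_eq_order hB'0] at this
  have : B'.order < B.order - 1 := by exact_mod_cast this
  omega

/-- The subresultant lies in the left ideal and has order exactly one, so it divides both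
generators; being a left combination of them, it is divisible by every common right divisor. -/
theorem isGCRD_subres_one {φ : R →+* K} (hφ : ∀ a, φ a′ = (φ a)′) {A B : DiffOp R}
    (hB : (B.map φ).deg = B.order)
    (hA0 : 0 < A.order) (hB0 : 0 < B.order) (hAB : 3 ≤ A.order + B.order)
    (h1 : (1 : DiffOp K) ∉ Ideal.span {A.map φ, B.map φ})
    {G : DiffOp K} (hG : G ∈ Ideal.span {A.map φ, B.map φ}) (hG1 : G.deg = (1 : ℕ)) :
    IsGCRD ((subres 1 A B).map φ) (A.map φ) (B.map φ) ∧ ((subres 1 A B).map φ).order = 1 := by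
  have hdet := det_subresMatrix_one_ne_zero hφ hB hA0 hB0 h1 hG hG1
  have hS := map_mem_span_pair hφ (subres_one_mem_span A B hAB)
  have hlt : ∀ i, 1 < i → ((subres 1 A B).map φ).coeff i = 0 := fun i hi => by
    rw [coeff_map, coeff_subres_one, if_neg (by omega), if_neg (by omega), _root_.map_zero]
  have hne : ((subres 1 A B).map φ).coeff 1 ≠ 0 := by
    rwa [coeff_map, coeff_subres_one, if_neg one_ne_zero, if_pos rfl]
  have hS1 : ((subres 1 A B).map φ).deg = (1 : ℕ) := deg_eq_of hlt hne
  refine ⟨⟨exists_eq_mul_of_mem h1 hS hS1 (Ideal.subset_span (by simp)),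
    exists_eq_mul_of_mem h1 hS hS1 (Ideal.subset_span (by simp)), ?_⟩, order_eq_of hlt hne⟩
  rintro H ⟨T₁, hT₁⟩ ⟨T₂, hT₂⟩
  obtain ⟨X, Y, hXY⟩ := Submodule.mem_span_pair.1 hS
  refine ⟨X * T₁ + Y * T₂, ?_⟩
  rw [← hXY, add_mul, mul_assoc, mul_assoc, ← hT₁, ← hT₂, smul_eq_mul, smul_eq_mul]

end Field

/-! ### The action of `F[λ, μ]` on `F[∂]`. -/

section Action

variable {F : Type*} [Field F] [Differential F]

open DiffOp MvPolynomial

/-- Right multiplication by an operator, as a left linear endomorphism of `F[∂]`. -/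
noncomputable def mulRightEnd (P : DiffOp F) : Module.End F (DiffOp F) where
  toFun V := V * P
  map_add' U V := add_mul U V P
  map_smul' a V := smul_mul a V P

lemma mulRightEnd_comm {P Q : DiffOp F} (h : Commute P Q) :
    ∀ a ∈ ({mulRightEnd P, mulRightEnd Q} : Set (Module.End F (DiffOp F))),
      ∀ b ∈ ({mulRightEnd P, mulRightEnd Q} : Set (Module.End F (DiffOp F))), a * b = b * a := by
  have key : mulRightEnd P * mulRightEnd Q = mulRightEnd Q * mulRightEnd P := by
    ext1 V
    change V * Q * P = V * P * Q
    rw [mul_assoc, mul_assoc, h.eq]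
  rintro a (rfl | rfl) b (rfl | rfl)
  · rfl
  · exact key
  · exact key.symm
  · rfl

open scoped IsMulCommutative in
/-- The action of `F[λ, μ]` on `F[∂]` in which `F` acts by left multiplication, and `λ`, `μ` act
by right multiplication by the commuting operators `P`, `Q`. -/
noncomputable def act (P Q : DiffOp F) (h : Commute P Q) :
    MvPolynomial (Fin 2) F →ₐ[F] Module.End F (DiffOp F) :=
  haveI : IsMulCommutative (Algebra.adjoin F {mulRightEnd P, mulRightEnd Q}) :=
    Algebra.isMulCommutative_adjoin F (mulRightEnd_comm h)
  (Algebra.adjoin F {mulRightEnd P, mulRightEnd Q}).val.comp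
    (MvPolynomial.aeval ![⟨mulRightEnd P, Algebra.subset_adjoin (by simp)⟩,
      ⟨mulRightEnd Q, Algebra.subset_adjoin (by simp)⟩])

variable {P Q : DiffOp F} (h : Commute P Q)

lemma act_C (a : F) (V : DiffOp F) : act P Q h (C a) V = a • V := by
  rw [← MvPolynomial.algebraMap_eq, AlgHom.commutes]
  rfl

lemma act_X_zero (V : DiffOp F) : act P Q h (X 0) V = V * P := by
  have : act P Q h (X 0) = mulRightEnd P := by simp [act]
  rw [this]
  rfl

lemma act_X_one (V : DiffOp F) : act P Q h (X 1) V = V * Q := by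
  have : act P Q h (X 1) = mulRightEnd Q := by simp [act]
  rw [this]
  rfl

lemma act_mul (g k : MvPolynomial (Fin 2) F) (V : DiffOp F) :
    act P Q h (g * k) V = act P Q h g (act P Q h k V) := by
  rw [_root_.map_mul]
  rfl

lemma act_add (g k : MvPolynomial (Fin 2) F) (V : DiffOp F) :
    act P Q h (g + k) V = act P Q h g V + act P Q h k V := by
  rw [_root_.map_add]
  rfl

lemma act_smul (a : F) (g : MvPolynomial (Fin 2) F) (V : DiffOp F) :
    act P Q h (a • g) V = a • act P Q h g V := by
  rw [_root_.map_smul]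
  rfl

/-- Constants are central, so their left action is also a right multiplication, like that of `λ` and
`μ`. -/
lemma act_map (t : MvPolynomial (Fin 2) (constField F)) (V : DiffOp F) :
    act P Q h (MvPolynomial.map (constField F).subtype t) V = V * evalPair P Q h t := by
  induction t using MvPolynomial.induction_on generalizing V with
  | C c =>
    rw [MvPolynomial.map_C, act_C, ← MvPolynomial.algebraMap_eq, AlgHom.commutes,
      ← Algebra.commutes, ← Algebra.smul_def]
    rfl
  | add p q hp hq => rw [_root_.map_add, act_add, hp, hq, _root_.map_add, mul_add]
  | mul_X p i hp =>
    rw [_root_.map_mul, act_mul, MvPolynomial.map_X, hp, _root_.map_mul]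
    have hc := ((Commute.all p (X i)).map (evalPair P Q h)).eq
    rw [hc]
    fin_cases i
    · simp only [Fin.zero_eta, act_X_zero, evalPair_X_zero, mul_assoc]
    · simp only [Fin.mk_one, act_X_one, evalPair_X_one, mul_assoc]

lemma pairAlgebra_eq_range : pairAlgebra P Q = (evalPair P Q h).range := by
  apply le_antisymm
  · refine Algebra.adjoin_le ?_
    rintro _ (rfl | rfl)
    · exact ⟨X 0, evalPair_X_zero _ _ h⟩
    · exact ⟨X 1, evalPair_X_one _ _ h⟩
  · rintro _ ⟨t, rfl⟩
    simp [evalPair]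

end Action

/-! ### Leading coefficients of operators commuting with a given one. -/

section LeadingCoeff

variable {F : Type*} [Field F] [Differential F]

open DiffOp

/-- In the subleading coefficients of `P T = T P`, the products of a leading with a subleading
coefficient cancel; only the derivative terms survive. -/
lemma leading_coeff_relation {P T : DiffOp F} (hT : Commute P T) {n k : ℕ}
    (hP : ∀ i, n + 1 < i → P.coeff i = 0) (hTk : ∀ i, k + 1 < i → T.coeff i = 0) :
    (n + 1) * P.coeff (n + 1) * (T.coeff (k + 1))′ =
      (k + 1) * T.coeff (k + 1) * (P.coeff (n + 1))′ := by
  have h1 := coeff_mul_second hP hTk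
  have h2 := coeff_mul_second hTk hP
  rw [hT.eq, show n + k + 1 = k + n + 1 by ring, h2] at h1
  linear_combination -h1

variable [CharZero F]

/-- Both leading coefficients solve the same first-order linear equation determined by `P`, so their
quotient is a constant. Characteristic zero makes the factor `n + 1` invertible. -/
lemma deriv_div_eq_zero_of_succ {P T S : DiffOp F} (hT : Commute P T) (hS : Commute P S)
    {n k : ℕ} (hP : P.deg = (n + 1 : ℕ)) (hTk : T.deg = (k + 1 : ℕ)) (hSk : S.deg = (k + 1 : ℕ)) :
    (T.coeff (k + 1) / S.coeff (k + 1))′ = 0 := by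
  have bound : ∀ {U : DiffOp F} {j : ℕ}, U.deg = j →
      (∀ i, j < i → U.coeff i = 0) ∧ U.coeff j ≠ 0 := by
    intro U j hU
    have h0 : U ≠ 0 := by rintro rfl; simp [deg_eq_bot.2 rfl] at hU
    rw [deg_eq_order h0] at hU
    have hU : U.order = j := by exact_mod_cast hU
    exact ⟨fun i hi => coeff_eq_zero_of_order_lt (by omega), hU ▸ coeff_order_ne_zero h0⟩
  obtain ⟨hP1, hP0⟩ := bound hP
  obtain ⟨hT1, hT0⟩ := bound hTk
  obtain ⟨hS1, hS0⟩ := bound hSk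
  have e1 := leading_coeff_relation hT hP1 hT1
  have e2 := leading_coeff_relation hS hP1 hS1
  have hn : ((n : F) + 1) * P.coeff (n + 1) ≠ 0 :=
    mul_ne_zero (by exact_mod_cast n.succ_ne_zero) hP0
  have e3 : (T.coeff (k + 1))′ * S.coeff (k + 1) = T.coeff (k + 1) * (S.coeff (k + 1))′ := by
    apply mul_left_cancel₀ hn
    linear_combination S.coeff (k + 1) * e1 - T.coeff (k + 1) * e2
  rw [Derivation.leibniz_div]
  simp only [smul_eq_mul]
  rw [show S.coeff (k + 1) * (T.coeff (k + 1))′ - T.coeff (k + 1) * (S.coeff (k + 1))′ = 0 by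
    linear_combination e3, mul_zero]

/-- Two operators of the same order that commute with an operator of positive order have
proportional leading coefficients over the field of constants. -/
lemma exists_constField_sub_deg_lt {P T S : DiffOp F} (hT : Commute P T) (hS : Commute P S)
    (hP : 0 < P.order) {k : ℕ} (hTk : T.deg = k) (hSk : S.deg = k) :
    ∃ c : constField F, (T - (c : F) • S).deg < k := by
  have hP0 : P ≠ 0 := by rintro rfl; exact absurd hP (lt_irrefl _)
  obtain ⟨n, hn⟩ : ∃ n, P.order = n + 1 := ⟨P.order - 1, by omega⟩
  have hPd : P.deg = (n + 1 : ℕ) := by rw [deg_eq_order hP0, hn]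
  have top : ∀ {U : DiffOp F} {j : ℕ}, U.deg = j → ∀ i, j < i → U.coeff i = 0 := by
    intro U j hU i hi
    have : U.deg < (i : ℕ) := by rw [hU]; exact_mod_cast hi
    exact deg_lt_iff.1 this i le_rfl
  have hlt : ∀ {U : DiffOp F}, U.deg = k → (U * P).deg = (k + n + 1 : ℕ) := by
    intro U hU
    rw [deg_mul, hU, hPd]
    rfl
  have hcoef : ∀ {U : DiffOp F}, U.deg = k →
      (U * P).coeff (k + n + 1) = U.coeff k * P.coeff (n + 1) := fun hU =>
    coeff_mul_top (top hU) (top hPd)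
  -- Multiplying by `P` makes the order positive even for `k = 0` and leaves the quotient of the
  -- leading coefficients unchanged.
  have hd := deriv_div_eq_zero_of_succ (hT.mul_right (Commute.refl P))
    (hS.mul_right (Commute.refl P)) hPd (hlt hTk) (hlt hSk)
  have hPc : P.coeff (n + 1) ≠ 0 := hn ▸ coeff_order_ne_zero hP0
  have hS0 : S ≠ 0 := by rintro rfl; simp [deg_eq_bot.2 rfl] at hSk
  have hSc : S.coeff k ≠ 0 := by
    have := hSk
    rw [deg_eq_order hS0] at this
    have : S.order = k := by exact_mod_cast this
    exact this ▸ coeff_order_ne_zero hS0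
  rw [hcoef hTk, hcoef hSk, mul_div_mul_right _ _ hPc] at hd
  refine ⟨⟨T.coeff k / S.coeff k, hd⟩, deg_lt_iff.2 fun i hi => ?_⟩
  rw [coeff_sub, coeff_smul]
  rcases hi.eq_or_lt with rfl | hi
  · field_simp
    ring
  · rw [top hTk i hi, top hSk i hi, mul_zero, sub_zero]

end LeadingCoeff

/-! ### The order filtration of `F[λ, μ]` and injectivity of the action. -/

section Filtration

variable {F : Type*} [Field F] [Differential F] {P Q : DiffOp F} (h : Commute P Q)

open DiffOp

/-- The `F`-span in `F[λ, μ]` of the polynomials `t` with constant coefficients for which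
`t(P, Q)` has order less than `j`. -/
noncomputable def orderFiltration (j : ℕ) : Submodule F (MvPolynomial (Fin 2) F) :=
  Submodule.span F {g | ∃ t, g = MvPolynomial.map (constField F).subtype t ∧
    (evalPair P Q h t).deg < j}

lemma orderFiltration_mono : Monotone (orderFiltration h) := by
  intro i j hij
  refine Submodule.span_mono ?_
  rintro _ ⟨t, rfl, ht⟩
  exact ⟨t, rfl, ht.trans_le (by exact_mod_cast hij)⟩

lemma exists_mem_orderFiltration (g : MvPolynomial (Fin 2) F) : ∃ j, g ∈ orderFiltration h j := by
  induction g using MvPolynomial.induction_on' with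
  | monomial u a =>
    set t : MvPolynomial (Fin 2) (constField F) := MvPolynomial.monomial u 1
    refine ⟨(evalPair P Q h t).order + 1, ?_⟩
    have : MvPolynomial.monomial u a = a • MvPolynomial.map (constField F).subtype t := by
      rw [MvPolynomial.map_monomial, _root_.map_one, MvPolynomial.smul_monomial, smul_eq_mul,
        mul_one]
    rw [this]
    exact Submodule.smul_mem _ _ (Submodule.subset_span
      ⟨t, rfl, deg_lt_iff.2 fun i hi => coeff_eq_zero_of_order_lt hi⟩)
  | add p q hp hq =>
    obtain ⟨i, hi⟩ := hp
    obtain ⟨j, hj⟩ := hq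
    exact ⟨max i j, add_mem (orderFiltration_mono h (le_max_left i j) hi)
      (orderFiltration_mono h (le_max_right i j) hj)⟩

lemma act_deg_lt_of_mem_orderFiltration {j : ℕ} {g : MvPolynomial (Fin 2) F}
    (hg : g ∈ orderFiltration h j) {V : DiffOp F} (hV : V ≠ 0) :
    (act P Q h g V).deg < (V.order + j : ℕ) := by
  induction hg using Submodule.span_induction with
  | mem x hx =>
    obtain ⟨t, rfl, ht⟩ := hx
    rw [act_map, deg_mul, deg_eq_order hV, Nat.cast_add]
    exact WithBot.add_lt_add_left WithBot.coe_ne_bot ht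
  | zero =>
    rw [_root_.map_zero, LinearMap.zero_apply, deg_eq_bot.2 rfl]
    exact WithBot.bot_lt_coe _
  | add x y _ _ hx hy =>
    rw [act_add]
    rw [deg_lt_iff] at *
    intro i hi
    rw [coeff_add, hx i hi, hy i hi, add_zero]
  | smul a x _ hx =>
    rw [act_smul]
    rw [deg_lt_iff] at *
    intro i hi
    rw [coeff_smul, hx i hi, mul_zero]

/-- Any two constant polynomials whose values have order `j` are proportional over the constants up
to lower order, so the graded piece is spanned over `F` by the class of one `t₀`. -/
lemma mem_orderFiltration_succ [CharZero F] (hP : 0 < P.order) {j : ℕ}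
    {g : MvPolynomial (Fin 2) F}
    (hg : g ∈ orderFiltration h (j + 1)) (hgj : g ∉ orderFiltration h j) :
    ∃ (a : F) (t : MvPolynomial (Fin 2) (constField F)), a ≠ 0 ∧ (evalPair P Q h t).deg = j ∧
      g - a • MvPolynomial.map (constField F).subtype t ∈ orderFiltration h j := by
  have hlt : ∀ t : MvPolynomial (Fin 2) (constField F), (evalPair P Q h t).deg < (j + 1 : ℕ) →
      ¬ (evalPair P Q h t).deg < j → (evalPair P Q h t).deg = j := by
    intro t h1 h2
    have h0 : evalPair P Q h t ≠ 0 := by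
      intro h0
      rw [h0, deg_eq_bot.2 rfl] at h2
      exact h2 (WithBot.bot_lt_coe _)
    rw [deg_eq_order h0] at h1 h2 ⊢
    have h1' : (evalPair P Q h t).order < j + 1 := by exact_mod_cast h1
    have h2' : ¬ (evalPair P Q h t).order < j := by exact_mod_cast h2
    rw [show (evalPair P Q h t).order = j by omega]
  by_cases hex : ∃ t₀, (evalPair P Q h t₀).deg = j
  · obtain ⟨t₀, ht₀⟩ := hex
    have hle : orderFiltration h (j + 1) ≤ orderFiltration h j ⊔
        Submodule.span F {MvPolynomial.map (constField F).subtype t₀} := by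
      refine Submodule.span_le.2 ?_
      rintro _ ⟨t, rfl, ht⟩
      by_cases htj : (evalPair P Q h t).deg < j
      · exact Submodule.mem_sup_left (Submodule.subset_span ⟨t, rfl, htj⟩)
      have hcomm : ∀ s, Commute P (evalPair P Q h s) := fun s => by
        have := (Commute.all (MvPolynomial.X 0) s).map (evalPair P Q h)
        rwa [evalPair_X_zero] at this
      obtain ⟨c, hc⟩ := exists_constField_sub_deg_lt (hcomm t) (hcomm t₀) hP (hlt t ht htj) ht₀
      have e : MvPolynomial.map (constField F).subtype t =
          MvPolynomial.map (constField F).subtype (t - c • t₀) +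
            (c : F) • MvPolynomial.map (constField F).subtype t₀ := by
        rw [_root_.map_sub, MvPolynomial.smul_eq_C_mul, _root_.map_mul, MvPolynomial.map_C,
          MvPolynomial.smul_eq_C_mul]
        exact (sub_add_cancel _ _).symm
      rw [SetLike.mem_coe, e]
      refine Submodule.add_mem_sup (Submodule.subset_span ⟨_, rfl, ?_⟩)
        (Submodule.smul_mem _ _ (Submodule.mem_span_singleton_self _))
      rw [_root_.map_sub, _root_.map_smul]
      exact hc
    obtain ⟨e, he, y, hy, rfl⟩ := Submodule.mem_sup.1 (hle hg)
    obtain ⟨a, rfl⟩ := Submodule.mem_span_singleton.1 hy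
    refine ⟨a, t₀, ?_, ht₀, by rwa [add_sub_cancel_right]⟩
    rintro rfl
    rw [zero_smul, add_zero] at hgj
    exact hgj he
  · refine absurd ?_ hgj
    refine Submodule.span_mono ?_ hg
    rintro _ ⟨t, rfl, ht⟩
    refine ⟨t, rfl, ?_⟩
    by_contra htj
    exact hex ⟨t, hlt t ht htj⟩

lemma act_apply_ne_zero [CharZero F] (hP : 0 < P.order) {g : MvPolynomial (Fin 2) F}
    (hg : g ∉ orderFiltration h 0) {V : DiffOp F} (hV : V ≠ 0) : act P Q h g V ≠ 0 := by
  classical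
  have hex := exists_mem_orderFiltration h g
  have h0 : Nat.find hex ≠ 0 := fun h0 => hg (h0 ▸ Nat.find_spec hex)
  obtain ⟨j, hj⟩ := Nat.exists_eq_succ_of_ne_zero h0
  obtain ⟨a, t, ha, ht, he⟩ := mem_orderFiltration_succ h hP (j := j)
    -- Take the least step of the filtration containing `g` and split off its leading part `a t`. If
    -- `g · V = 0`, the lower part would send `V` to `-a V t(P, Q)`, of order `ord V + j`, which is
    -- too large.
    (by have := Nat.find_spec hex; rwa [hj] at this) (Nat.find_min hex (by omega))
  intro hz
  have hlt := act_deg_lt_of_mem_orderFiltration h he hV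
  have e : act P Q h (g - a • MvPolynomial.map (constField F).subtype t) V =
      -(const a * (V * evalPair P Q h t)) := by
    rw [_root_.map_sub, LinearMap.sub_apply, hz, act_smul, act_map, zero_sub, const_mul]
  have hneg : ∀ U : DiffOp F, (-U).deg = U.deg := fun U => Polynomial.degree_neg U
  rw [e, hneg, deg_mul, deg_mul, ht, deg_eq_order hV,
    show (const a : DiffOp F).deg = 0 from Polynomial.degree_C ha, zero_add, Nat.cast_add] at hlt
  exact lt_irrefl _ hlt

end Filtration

/-! ### The ideal `[f]` is the annihilator, and it is prime. -/

section CurveIdeal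

variable {F : Type*} [Field F] [Differential F] {P Q : DiffOp F} (h : Commute P Q)
  {f : MvPolynomial (Fin 2) (constField F)}

open DiffOp

lemma deriv_map_constField (t : MvPolynomial (Fin 2) (constField F)) :
    (MvPolynomial.map (constField F).subtype t)′ = 0 := by
  induction t using MvPolynomial.induction_on with
  | C c =>
    rw [MvPolynomial.map_C, mv_deriv_C]
    have : ((constField F).subtype c)′ = 0 := c.2
    rw [this, _root_.map_zero]
  | add p q hp hq => rw [_root_.map_add, _root_.map_add, hp, hq, add_zero]
  | mul_X p i hp =>
    rw [_root_.map_mul, MvPolynomial.map_X, Derivation.leibniz, hp, mv_deriv_X]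
    simp

variable (hf : BC P Q h = Ideal.span {f})
include hf

lemma act_eq_zero_of_mem_curveIdeal {g : MvPolynomial (Fin 2) F} (hg : g ∈ curveIdeal f) :
    act P Q h g = 0 := by
  induction hg using Submodule.span_induction with
  | mem x hx =>
    obtain ⟨s, hs, k, rfl⟩ := hx
    obtain rfl : s = _ := hs
    cases k with
    | zero =>
      have hf0 : evalPair P Q h f = 0 := by
        have : f ∈ BC P Q h := hf ▸ Ideal.mem_span_singleton_self f
        exact this
      ext1 V
      rw [Function.iterate_zero, id, act_map, hf0, mul_zero]
      rfl
    | succ k =>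
      have : ∀ k : ℕ, (fun y : MvPolynomial (Fin 2) F => y′)^[k] 0 = 0 := by
        intro k
        exact Function.iterate_fixed (_root_.map_zero _) k
      -- The coefficients of `f` are constants, so all its derivatives vanish.
      rw [Function.iterate_succ_apply, deriv_map_constField, this, _root_.map_zero]
  | zero => exact _root_.map_zero _
  | add x y _ _ hx hy => rw [_root_.map_add, hx, hy, add_zero]
  | smul a x _ hx => rw [smul_eq_mul, _root_.map_mul, hx, mul_zero]

/-- Order below `0` means `t(P, Q) = 0`, that is, `t` is a multiple of `f`. -/
lemma orderFiltration_zero_le {g : MvPolynomial (Fin 2) F} (hg : g ∈ orderFiltration h 0) :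
    g ∈ curveIdeal f := by
  induction hg using Submodule.span_induction with
  | mem x hx =>
    obtain ⟨t, rfl, ht⟩ := hx
    have ht0 : t ∈ BC P Q h := by
      change evalPair P Q h t = 0
      exact ext_coeff fun i => by rw [deg_lt_iff.1 ht i (Nat.zero_le _), coeff_zero]
    rw [hf] at ht0
    obtain ⟨s, rfl⟩ := Ideal.mem_span_singleton'.1 ht0
    rw [_root_.map_mul]
    exact Ideal.mul_mem_left _ _ (Ideal.subset_span ⟨_, rfl, 0, rfl⟩)
  | zero => exact zero_mem _
  | add x y _ _ hx hy => exact add_mem hx hy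
  | smul a x _ hx => rw [MvPolynomial.smul_eq_C_mul]; exact Ideal.mul_mem_left _ _ hx

lemma act_apply_ne_zero_of_notMem_curveIdeal [CharZero F] (hP : 0 < P.order)
    {g : MvPolynomial (Fin 2) F}
    (hg : g ∉ curveIdeal f) {V : DiffOp F} (hV : V ≠ 0) : act P Q h g V ≠ 0 :=
  act_apply_ne_zero h hP (fun hg' => hg (orderFiltration_zero_le h hf hg')) hV

/-- A product acts by composition, and elements outside `[f]` send nonzero operators to nonzero
operators. -/
theorem curveIdeal_isPrime [CharZero F] (hP : 0 < P.order) : (curveIdeal f).IsPrime := by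
  constructor
  · intro htop
    have h1 := act_eq_zero_of_mem_curveIdeal h hf (htop ▸ Submodule.mem_top :
      (1 : MvPolynomial (Fin 2) F) ∈ curveIdeal f)
    rw [_root_.map_one] at h1
    have : P = 0 := congrArg (fun φ : Module.End F (DiffOp F) => φ P) h1
    rw [this] at hP
    exact absurd hP (lt_irrefl _)
  · intro g k hgk
    by_contra! hne
    have h1 := act_apply_ne_zero_of_notMem_curveIdeal h hf hP hne.2 (one_ne_zero : (1 : DiffOp F) ≠ 0)
    have h2 := act_apply_ne_zero_of_notMem_curveIdeal h hf hP hne.1 h1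
    rw [← act_mul, act_eq_zero_of_mem_curveIdeal h hf hgk] at h2
    exact h2 rfl

end CurveIdeal

/-! ### Rank one and finite codimension of the cyclic submodule. -/

section Torsion

variable {F : Type*} [Field F] [Differential F] {P Q : DiffOp F} (h : Commute P Q)

open DiffOp

/-- The orders of nonzero elements of `C[P, Q]` form an additive monoid; with greatest common
divisor `1` it contains all large integers. -/
lemma exists_deg_evalPair_eq (hP : 0 < P.order)
    (hrank : rank (pairAlgebra P Q : Set (DiffOp F)) = 1) :
    ∃ c : ℕ, ∀ j ≥ c, ∃ t, (evalPair P Q h t).deg = j := by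
  let S : Set ℕ := {j | ∃ T ∈ pairAlgebra P Q, T ≠ 0 ∧ T.order = j}
  have hP0 : P ≠ 0 := by rintro rfl; exact absurd hP (lt_irrefl _)
  have hPA : P ∈ pairAlgebra P Q := Algebra.subset_adjoin (by simp)
  have hPS : P.order ∈ S := ⟨P, hPA, hP0, rfl⟩
  have hgcd : Nat.setGcd S = 1 := by
    have hmem : Nat.setGcd S ∈
        {d : ℕ | ∀ T ∈ (pairAlgebra P Q : Set (DiffOp F)), T ≠ 0 → d ∣ T.order} :=
      fun T hT hT0 => Nat.setGcd_dvd_of_mem ⟨T, hT, hT0, rfl⟩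
    have hle : Nat.setGcd S ≤ 1 := by
      rw [← hrank]
      exact le_csSup ⟨P.order, fun d hd => Nat.le_of_dvd hP (hd P hPA hP0)⟩ hmem
    have hne : Nat.setGcd S ≠ 0 := fun h0 => by
      have := Nat.setGcd_dvd_of_mem hPS
      rw [h0, zero_dvd_iff] at this
      omega
    omega
  have hclosure : ∀ j ∈ AddSubmonoid.closure S, j ∈ S := by
    intro j hj
    induction hj using AddSubmonoid.closure_induction with
    | mem x hx => exact hx
    | zero => exact ⟨1, one_mem _, one_ne_zero, Polynomial.natDegree_C 1⟩
    | add x y _ _ hx hy =>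
      obtain ⟨T, hT, hT0, rfl⟩ := hx
      obtain ⟨U, hU, hU0, rfl⟩ := hy
      refine ⟨T * U, mul_mem hT hU, mul_ne_zero hT0 hU0, ?_⟩
      have := deg_mul T U
      rw [deg_eq_order hT0, deg_eq_order hU0, deg_eq_order (mul_ne_zero hT0 hU0)] at this
      exact_mod_cast this
  obtain ⟨c, hc⟩ := Nat.exists_mem_closure_of_ge S
  refine ⟨c, fun j hj => ?_⟩
  obtain ⟨T, hT, hT0, hTj⟩ := hclosure j (hc j hj (hgcd ▸ one_dvd j))
  rw [pairAlgebra_eq_range h] at hT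
  obtain ⟨t, ht⟩ := hT
  refine ⟨t, ?_⟩
  have ht : evalPair P Q h t = T := ht
  rw [ht, deg_eq_order hT0, hTj]

/-- If `C[P, Q]` has rank one, then `∂` is a torsion element modulo the cyclic `F[λ, μ]`-module
generated by `1`. -/
lemma exists_act_del_eq_act_one (hP : 0 < P.order)
    (hrank : rank (pairAlgebra P Q : Set (DiffOp F)) = 1) :
    ∃ r s : MvPolynomial (Fin 2) F, act P Q h r 1 ≠ 0 ∧ act P Q h r del = act P Q h s 1 := by
  obtain ⟨c, hc⟩ := exists_deg_evalPair_eq h hP hrank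
  let ev : MvPolynomial (Fin 2) F →ₗ[F] DiffOp F :=
    LinearMap.applyₗ (1 : DiffOp F) ∘ₗ (act P Q h).toLinearMap
  let N := LinearMap.range ev
  let κ : MvPolynomial (Fin 2) F →ₗ[F] DiffOp F ⧸ N :=
    N.mkQ ∘ₗ LinearMap.applyₗ (del : DiffOp F) ∘ₗ (act P Q h).toLinearMap
  let ι : Polynomial.degreeLT F c →ₗ[F] DiffOp F ⧸ N :=
    N.mkQ ∘ₗ (ofPoly : Polynomial F ≃ₗ[F] DiffOp F).toLinearMap ∘ₗ
      (Polynomial.degreeLT F c).subtype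
  -- From order `c` on, leading terms can be removed by `F`-multiples of elements `t(P, Q)`, which
  -- lie in `N`; so operators of order below `c` span the quotient.
  have hι : ∀ (n : ℕ) (V : DiffOp F), V.deg < n → N.mkQ V ∈ LinearMap.range ι := by
    intro n
    induction n with
    | zero =>
      intro V hV
      have : V = 0 := ext_coeff fun i => by rw [deg_lt_iff.1 hV i (Nat.zero_le _), coeff_zero]
      rw [this, _root_.map_zero]
      exact zero_mem _
    | succ n ih =>
      intro V hV
      by_cases hVc : V.deg < c
      · exact ⟨⟨ofPoly.symm V, Polynomial.mem_degreeLT.2 hVc⟩, rfl⟩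
      have hV0 : V ≠ 0 := by
        rintro rfl
        rw [deg_eq_bot.2 rfl] at hVc
        exact hVc (WithBot.bot_lt_coe _)
      rw [deg_eq_order hV0] at hV hVc
      have hVn : V.order < n + 1 := by exact_mod_cast hV
      have hVc : c ≤ V.order := by rw [not_lt] at hVc; exact_mod_cast hVc
      obtain ⟨t, ht⟩ := hc _ hVc
      obtain ⟨a, ha⟩ := exists_sub_deg_lt (deg_eq_order hV0) ht
      have := ih _ (ha.trans_le (by exact_mod_cast Nat.lt_succ_iff.1 hVn))
      have hN : N.mkQ (a • evalPair P Q h t) = 0 := by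
        rw [Submodule.mkQ_apply, Submodule.Quotient.mk_eq_zero]
        refine ⟨a • MvPolynomial.map (constField F).subtype t, ?_⟩
        change act P Q h _ 1 = _
        rw [act_smul, act_map, one_mul]
      rwa [_root_.map_sub, hN, sub_zero] at this
  have hfin : Module.Finite F (DiffOp F ⧸ N) := by
    have : Module.Finite F (Polynomial.degreeLT F c) :=
      Module.Finite.equiv (Polynomial.degreeLTEquiv F c).symm
    refine Module.Finite.of_surjective ι fun w => ?_
    obtain ⟨V, rfl⟩ := N.mkQ_surjective w
    exact hι (V.order + 1) V (deg_lt_iff.2 fun i hi => coeff_eq_zero_of_order_lt hi)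
  by_contra! hno
  -- If no such `r`, `s` exist, then `r · ∂ ∈ N` forces `r · 1 = 0`. So `N` is a quotient of the
  -- image of `κ`, hence finite-dimensional, and `F[∂]` would be finite-dimensional too.
  have hker : LinearMap.ker κ ≤ LinearMap.ker ev := by
    intro r hr
    rw [LinearMap.mem_ker] at hr ⊢
    change N.mkQ (act P Q h r del) = 0 at hr
    rw [Submodule.mkQ_apply, Submodule.Quotient.mk_eq_zero] at hr
    obtain ⟨s, hs⟩ := hr
    by_contra hne
    exact hno r s hne hs.symm
  have hfinκ : Module.Finite F (MvPolynomial (Fin 2) F ⧸ LinearMap.ker κ) :=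
    Module.Finite.equiv κ.quotKerEquivRange.symm
  have hfinN : Module.Finite F N := by
    refine Module.Finite.of_surjective ((LinearMap.ker κ).liftQ ev.rangeRestrict ?_) ?_
    · rwa [LinearMap.ker_rangeRestrict]
    · rw [← LinearMap.range_eq_top, Submodule.range_liftQ, LinearMap.range_rangeRestrict]
  have : Module.Finite F (DiffOp F) := Module.Finite.of_submodule_quotient N
  exact Polynomial.not_finite (R := F) this

end Torsion

/-! ### Reduction of `F[λ, μ][∂]` modulo `P - λ` and `Q - μ`. -/

section Reduction

variable {F : Type*} [Field F] [Differential F] {P Q : DiffOp F} (h : Commute P Q)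

open DiffOp

lemma map_C_deriv (a : F) : (MvPolynomial.C a′ : MvPolynomial (Fin 2) F) = (MvPolynomial.C a)′ :=
  (mv_deriv_C a).symm

/-- Modulo the left ideal generated by `P - λ` and `Q - μ`, every operator over `F[λ, μ]` is
congruent to an operator over `F`. -/
lemma smul_map_sub_mem (g : MvPolynomial (Fin 2) F) (V : DiffOp F) :
    g • V.map MvPolynomial.C - (act P Q h g V).map MvPolynomial.C ∈
      Ideal.span {shift P 0, shift Q 1} := by
  have step : ∀ (p : MvPolynomial (Fin 2) F) (i : Fin 2) (A W : DiffOp F),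
      shift A i ∈ Ideal.span {shift P 0, shift Q 1} →
      p • (W * A).map MvPolynomial.C - (act P Q h p (W * A)).map MvPolynomial.C ∈
        Ideal.span {shift P 0, shift Q 1} →
      (p * MvPolynomial.X i) • W.map MvPolynomial.C - (act P Q h p (W * A)).map MvPolynomial.C ∈
        Ideal.span {shift P 0, shift Q 1} := by
    intro p i A W hA hp
    -- A variable commutes with `∂`, so `p W λ = p W P - p W (P - λ)`, and likewise for `μ` and `Q`.
    have e : (p * MvPolynomial.X i) • W.map MvPolynomial.C =
        p • (W * A).map MvPolynomial.C - const p * W.map MvPolynomial.C * shift A i := by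
      rw [shift, mul_sub, mul_assoc, mul_assoc, ← DiffOp.map_mul map_C_deriv,
        mul_const_of_constant (mv_deriv_X i), const_mul, const_mul, sub_sub_cancel, smul_smul]
    rw [e, sub_right_comm]
    exact sub_mem hp (Ideal.mul_mem_left _ _ hA)
  induction g using MvPolynomial.induction_on generalizing V with
  | C a => rw [act_C, DiffOp.map_smul, sub_self]; exact zero_mem _
  | add p q hp hq =>
    rw [act_add, add_smul, DiffOp.map_add, add_sub_add_comm]
    exact add_mem (hp V) (hq V)
  | mul_X p i hp =>
    rw [act_mul]
    fin_cases i
    · simp only [Fin.zero_eta, act_X_zero]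
      exact step p 0 P V (Ideal.subset_span (by simp)) (hp _)
    · simp only [Fin.mk_one, act_X_one]
      exact step p 1 Q V (Ideal.subset_span (by simp)) (hp _)

/-- The map `F[λ, μ][∂] → F[∂]`, `∑ gᵢ ∂ⁱ ↦ ∑ gᵢ · ∂ⁱ`, given by the action of `F[λ, μ]` on
`F[∂]`. -/
noncomputable def reduction : DiffOp (MvPolynomial (Fin 2) F) →ₗ[F] DiffOp F :=
  Polynomial.lsum fun i => LinearMap.applyₗ ((del : DiffOp F) ^ i) ∘ₗ (act P Q h).toLinearMap

lemma reduction_apply (Z : DiffOp (MvPolynomial (Fin 2) F)) :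
    reduction h Z = (ofPoly.symm Z).sum fun i g => act P Q h g (del ^ i) :=
  Polynomial.lsum_apply _ _

lemma reduction_smul_del_pow (g : MvPolynomial (Fin 2) F) (i : ℕ) :
    reduction h (g • del ^ i) = act P Q h g (del ^ i) := by
  have : ofPoly.symm (g • del ^ i : DiffOp (MvPolynomial (Fin 2) F)) =
      Polynomial.monomial i g := by
    refine Polynomial.ext fun j => ?_
    change coeff (g • del ^ i) j = _
    rw [coeff_smul, coeff_del_pow, Polynomial.coeff_monomial]
    simp [eq_comm]
  rw [reduction_apply, this, Polynomial.sum_monomial_index]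
  rw [_root_.map_zero, LinearMap.zero_apply]

lemma reduction_smul (g : MvPolynomial (Fin 2) F) (Z : DiffOp (MvPolynomial (Fin 2) F)) :
    reduction h (g • Z) = act P Q h g (reduction h Z) := by
  rw [eq_sum Z, Finset.smul_sum, _root_.map_sum, _root_.map_sum, _root_.map_sum]
  refine Finset.sum_congr rfl fun i _ => ?_
  rw [smul_smul, reduction_smul_del_pow, act_mul, reduction_smul_del_pow]

lemma reduction_map (V : DiffOp F) : reduction h (V.map MvPolynomial.C) = V := by
  have e : V.map (MvPolynomial.C (σ := Fin 2)) = ∑ i ∈ Finset.range (V.order + 1),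
      (MvPolynomial.C (V.coeff i) : MvPolynomial (Fin 2) F) • (del : DiffOp (MvPolynomial (Fin 2) F)) ^ i := by
    conv_lhs => rw [eq_sum V, DiffOp.map_sum]
    refine Finset.sum_congr rfl fun i _ => ?_
    rw [DiffOp.map_smul, ← mul_one (del ^ i), map_del_pow_mul map_C_deriv, DiffOp.map_one, mul_one]
  rw [e, _root_.map_sum]
  conv_rhs => rw [eq_sum V]
  refine Finset.sum_congr rfl fun i _ => ?_
  rw [reduction_smul_del_pow, act_C]

/-- By linearity it suffices to treat `∂^k (A - X i) = ∂^k A - X i ∂^k`, where the variable acts on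
`∂^k` by the same right multiplication by `A`. -/
lemma reduction_mul_shift {A : DiffOp F} {i : Fin 2}
    (hA : ∀ V, act P Q h (MvPolynomial.X i) V = V * A) (Z : DiffOp (MvPolynomial (Fin 2) F)) :
    reduction h (Z * shift A i) = 0 := by
  rw [eq_sum Z, Finset.sum_mul, _root_.map_sum]
  refine Finset.sum_eq_zero fun k _ => ?_
  have hk : (del : DiffOp (MvPolynomial (Fin 2) F)) ^ k =
      ((del : DiffOp F) ^ k).map MvPolynomial.C := by
    rw [← mul_one ((del : DiffOp F) ^ k), map_del_pow_mul map_C_deriv, DiffOp.map_one, mul_one]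
  rw [smul_mul, reduction_smul, shift, mul_sub, mul_const_of_constant (mv_deriv_X i),
    _root_.map_sub, reduction_smul, hk, ← DiffOp.map_mul map_C_deriv, reduction_map, reduction_map, hA,
    sub_self, _root_.map_zero]

lemma reduction_eq_zero_of_mem {Z : DiffOp (MvPolynomial (Fin 2) F)}
    (hZ : Z ∈ Ideal.span {shift P 0, shift Q 1}) : reduction h Z = 0 := by
  obtain ⟨X, Y, rfl⟩ := Submodule.mem_span_pair.1 hZ
  rw [smul_eq_mul, smul_eq_mul, _root_.map_add, reduction_mul_shift h (act_X_zero h),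
    reduction_mul_shift h (act_X_one h), add_zero]

lemma coeff_shift (P : DiffOp F) (i : Fin 2) {j : ℕ} (hj : j ≠ 0) :
    (shift P i).coeff j = MvPolynomial.C (P.coeff j) := by
  rw [shift, coeff_sub, coeff_map, coeff_const, if_neg hj, sub_zero]

lemma order_shift {P : DiffOp F} (hP : 0 < P.order) (i : Fin 2) :
    (shift P i).order = P.order := by
  have hP0 : P ≠ 0 := by rintro rfl; exact absurd hP (lt_irrefl _)
  refine order_eq_of (fun j hj => ?_) ?_
  · rw [coeff_shift P i (by omega), coeff_eq_zero_of_order_lt hj, _root_.map_zero]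
  · rw [coeff_shift P i hP.ne']
    exact (map_ne_zero_iff _ (MvPolynomial.C_injective (Fin 2) F)).2 (coeff_order_ne_zero hP0)

end Reduction

/-! ### The left ideal generated over `F(Γ)`. -/

section CurveField

variable {F : Type*} [Field F] [Differential F] {P Q : DiffOp F} (h : Commute P Q)
  {f : MvPolynomial (Fin 2) (constField F)}

open DiffOp

lemma toCurveField_deriv (f : MvPolynomial (Fin 2) (constField F)) (a : MvPolynomial (Fin 2) F) :
    toCurveField f a′ = (toCurveField f a)′ := by
  simp only [toCurveField, RingHom.comp_apply]
  rw [frac_deriv_algebraMap, quot_deriv_mk]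

lemma toCurveField_eq_zero_iff {a : MvPolynomial (Fin 2) F} :
    toCurveField f a = 0 ↔ a ∈ curveIdeal f := by
  rw [toCurveField, RingHom.comp_apply, ← Ideal.Quotient.eq_zero_iff_mem]
  exact map_eq_zero_iff _ (IsFractionRing.injective (CurveRing f) (CurveField f))

/-- Clearing denominators in an operator over `F(Γ)`. -/
lemma exists_smul_eq_map [(curveIdeal f).IsPrime] (X : DiffOp (CurveField f)) :
    ∃ d ∉ curveIdeal f, ∃ Y : DiffOp (MvPolynomial (Fin 2) F),
      toCurveField f d • X = Y.map (toCurveField f) := by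
  suffices H : ∀ X : Polynomial (CurveField f), ∃ d ∉ curveIdeal f,
      ∃ Y : DiffOp (MvPolynomial (Fin 2) F), toCurveField f d • ofPoly X = Y.map (toCurveField f)
    from H (ofPoly.symm X)
  intro X
  induction X using Polynomial.induction_on' with
  | add p q hp hq =>
    obtain ⟨d, hd, Y, hY⟩ := hp
    obtain ⟨e, he, Z, hZ⟩ := hq
    refine ⟨d * e, fun hde => (Ideal.IsPrime.mem_or_mem ‹_› hde).elim hd he, e • Y + d • Z, ?_⟩
    rw [DiffOp.map_add, DiffOp.map_smul, DiffOp.map_smul, ← hY, ← hZ, smul_smul, smul_smul,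
      _root_.map_add, smul_add, _root_.map_mul, mul_comm]
  | monomial k a =>
    obtain ⟨x, y, hy, rfl⟩ := IsFractionRing.div_surjective (A := CurveRing f) a
    obtain ⟨x, rfl⟩ := Ideal.Quotient.mk_surjective x
    obtain ⟨y, rfl⟩ := Ideal.Quotient.mk_surjective y
    have hy' : y ∉ curveIdeal f := fun h =>
      nonZeroDivisors.ne_zero hy (Ideal.Quotient.eq_zero_iff_mem.2 h)
    have hy0 : toCurveField f y ≠ 0 := fun h => hy' (toCurveField_eq_zero_iff.1 h)
    refine ⟨y, hy', ofPoly (Polynomial.monomial k x), ?_⟩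
    change toCurveField f y • Polynomial.monomial k (toCurveField f x / toCurveField f y) =
      Polynomial.map _ (Polynomial.monomial k x)
    rw [Polynomial.map_monomial, Polynomial.smul_monomial, smul_eq_mul, mul_div_cancel₀ _ hy0]

variable (hf : BC P Q h = Ideal.span {f})
include hf

lemma reduction_eq_zero_of_map_eq_zero {Z : DiffOp (MvPolynomial (Fin 2) F)}
    (hZ : Z.map (toCurveField f) = 0) : reduction h Z = 0 := by
  rw [reduction_apply, Polynomial.sum]
  refine Finset.sum_eq_zero fun i _ => ?_
  have hi : toCurveField f (Z.coeff i) = 0 := by rw [← coeff_map, hZ, coeff_zero]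
  change act P Q h (Z.coeff i) _ = 0
  rw [act_eq_zero_of_mem_curveIdeal h hf (toCurveField_eq_zero_iff.1 hi)]
  rfl

/-- Clearing denominators in `1 = X (P - λ) + Y (Q - μ)` gives an identity over `F[λ, μ]` up to
coefficients in `[f]`. The reduction ignores these and kills the right-hand side, so `(d e) · 1 = 0`
with `d e ∉ [f]`. -/
lemma one_notMem_span_shift [CharZero F] (hP : 0 < P.order) :
    (1 : DiffOp (CurveField f)) ∉ Ideal.span
      {(shift P 0).map (toCurveField f), (shift Q 1).map (toCurveField f)} := by
  have hprime := curveIdeal_isPrime h hf hP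
  intro h1
  obtain ⟨X, Y, hXY⟩ := Submodule.mem_span_pair.1 h1
  obtain ⟨d, hd, X', hX⟩ := exists_smul_eq_map X
  obtain ⟨e, he, Y', hY⟩ := exists_smul_eq_map Y
  have hde : d * e ∉ curveIdeal f := fun hde => (hprime.mem_or_mem hde).elim hd he
  have hφ := toCurveField_deriv f
  have hmap : (const (d * e) - (e • X' * shift P 0 + d • Y' * shift Q 1)).map
      (toCurveField f) = 0 := by
    rw [DiffOp.map_sub, DiffOp.map_add, DiffOp.map_mul hφ, DiffOp.map_mul hφ, DiffOp.map_smul,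
      DiffOp.map_smul, ← hX, ← hY, DiffOp.map_const, smul_smul, smul_smul, smul_mul, smul_mul,
      mul_comm (toCurveField f e), ← _root_.map_mul, ← smul_add, ← smul_one_eq_const, ← hXY,
      smul_eq_mul, smul_eq_mul, sub_self]
  have hred := reduction_eq_zero_of_map_eq_zero h hf hmap
  have hmem : e • X' * shift P 0 + d • Y' * shift Q 1 ∈ Ideal.span {shift P 0, shift Q 1} :=
    Submodule.mem_span_pair.2 ⟨_, _, rfl⟩
  rw [_root_.map_sub, reduction_eq_zero_of_mem h hmem, sub_zero,
    ← smul_one_eq_const, ← pow_zero del, reduction_smul_del_pow, pow_zero] at hred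
  exact act_apply_ne_zero_of_notMem_curveIdeal h hf hP hde one_ne_zero hred

/-- Both `r ∂` and `s` are congruent to the same operator over `F`, namely `r · ∂ = s · 1`. -/
lemma exists_deg_one_mem_span_shift [CharZero F] (hP : 0 < P.order)
    (hrank : rank (pairAlgebra P Q : Set (DiffOp F)) = 1) :
    ∃ r s : MvPolynomial (Fin 2) F, r ∉ curveIdeal f ∧
      r • del - const s ∈ Ideal.span {shift P 0, shift Q 1} := by
  obtain ⟨r, s, hr, hrs⟩ := exists_act_del_eq_act_one h hP hrank
  refine ⟨r, s, fun hmem => hr ?_, ?_⟩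
  · rw [act_eq_zero_of_mem_curveIdeal h hf hmem]
    rfl
  · have := sub_mem (smul_map_sub_mem h r del) (smul_map_sub_mem h s 1)
    rwa [hrs, sub_sub_sub_cancel_right, DiffOp.map_one, map_del, smul_one_eq_const] at this

end CurveField

end BCPlanar

/-! ### The main theorem. -/

open BCPlanar
theorem theorem6 {F : Type*} [Field F] [Differential F]
    [IsAlgClosed (constField F)] [CharZero (constField F)]
    (P Q : DiffOp F) (hPQ : Commute P Q)
    (hP : 0 < P.order) (hQ : 0 < Q.order) (hone : ¬ (P.order = 1 ∧ Q.order = 1))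
    (f : MvPolynomial (Fin 2) (constField F)) (hf : BC P Q hPQ = Ideal.span {f})
    (hrank : rank (pairAlgebra P Q : Set (DiffOp F)) = 1) :
    (curveIdeal f).IsPrime ∧
    IsGCRD ((subres 1 (shift P 0) (shift Q 1)).map (toCurveField f))
      ((shift P 0).map (toCurveField f)) ((shift Q 1).map (toCurveField f)) ∧
    ((subres 1 (shift P 0) (shift Q 1)).map (toCurveField f)).order = 1 := by
  have : CharZero F := charZero_of_injective_ringHom (constField F).subtype.injective
  have hprime := curveIdeal_isPrime hPQ hf hP
  refine ⟨hprime, ?_⟩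
  obtain ⟨r, s, hr, hmem⟩ := exists_deg_one_mem_span_shift hPQ hf hP hrank
  have hφ := toCurveField_deriv f
  have hr0 : toCurveField f r ≠ 0 := fun h => hr (toCurveField_eq_zero_iff.1 h)
  have hQ0 : Q ≠ 0 := by rintro rfl; exact absurd hQ (lt_irrefl _)
  have hinj : Function.Injective ((toCurveField f).comp MvPolynomial.C) := RingHom.injective _
  -- Since `m > 0`, the leading coefficient of `Q - μ` is that of `Q`; it lies in the field `F`,
  -- which embeds in `F(Γ)`, so the order does not drop.
  have hB : ((shift Q 1).map (toCurveField f)).deg = (shift Q 1).order := by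
    rw [order_shift hQ]
    refine DiffOp.deg_eq_of (fun j hj => ?_) ?_
    · rw [DiffOp.coeff_map, coeff_shift Q 1 (by omega), DiffOp.coeff_eq_zero_of_order_lt hj,
        map_zero, map_zero]
    · rw [DiffOp.coeff_map, coeff_shift Q 1 hQ.ne']
      exact (map_ne_zero_iff _ hinj).2 (DiffOp.coeff_order_ne_zero hQ0)
  refine isGCRD_subres_one hφ hB (by rwa [order_shift hP]) (by rwa [order_shift hQ])
    (by rw [order_shift hP, order_shift hQ]; omega) (one_notMem_span_shift hPQ hf hP)
    (map_mem_span_pair hφ hmem) (DiffOp.deg_eq_of (fun i hi => ?_) ?_)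
  · rw [DiffOp.coeff_map, DiffOp.coeff_sub, DiffOp.coeff_smul, DiffOp.coeff_del,
      DiffOp.coeff_const, if_neg (by omega), if_neg (by omega), mul_zero, sub_zero, map_zero]
  · rw [DiffOp.coeff_map, DiffOp.coeff_sub, DiffOp.coeff_smul, DiffOp.coeff_del,
      DiffOp.coeff_const, if_pos rfl, if_neg one_ne_zero, mul_one, sub_zero]
    exact hr0
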